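/- All manifolds are smooth, finite-dimensional, without boundary, Hausdorff and second countable; all bundles, sections, maps and tensors are smooth. Let $E\to M$, with $n=\dim M$, be an exact Courant algebroid: a vector bundle with a nondegenerate symmetric pairing $\langle\cdot,\cdot\rangle$, an anchor $\rho\colon E\to TM$ and an $\mathbb R$-bilinear bracket on $\Gamma(E)$ such that for all $a,b,c\in\Gamma(E)$, $f\in C^\infty(M)$ $$[a,[b,c]]=[[a,b],c]+[b,[a,c]],\qquad \rho[a,b]=[\rho a,\rho b],\qquad [a,fb]=f[a,b]+(\rho(a)f)\,b,$$ $$\rho(a)\langle b,c\rangle=\langle[a,b],c\rangle+\langle b,[a,c]\rangle,\qquad [a,b]+[b,a]=\rho^*d\langle a,b\rangle ,$$ where $\rho^*\colon T^*M\to E$ is defined by $\langle\rho^*\alpha,e\rangle=\alpha(\rho e)$, and such that $0\to T^*M\xrightarrow{\rho^*}E\xrightarrow{\rho}TM\to0$ is exact. A splitting is a bundle map $s\colon TM\to E$ with $\rho\circ s=\mathrm{id}$ and isotropic image; it gives the identification $TM\oplus T^*M\cong E$, $(u,\alpha)\mapsto s(u)+\rho^*\alpha$, and its 3-form is $H(X,Y,Z)=\langle[sX,sY],sZ\rangle$.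 Let $D\subset E$ be a projectable (regular) small Dirac structure, i.e. a subbundle which is isotropic, satisfies $[\Gamma(D),\Gamma(D)]\subset\Gamma(D)$, and on which $\rho$ is injective. Let $W\subset E$ be a $D$-transverse generalized metric, i.e. a subbundle of rank $n$ with $D\subset W\subset D^\perp$, with $\langle w,w\rangle>0$ for every $w\in W\setminus D$, and with $[\Gamma(D),\Gamma(W)]\subset\Gamma(W)$. **Proposition.** Suppose that the leaves (maximal connected integral manifolds) of the foliation $\rho(D)\subset TM$ are exactly the fibres of a surjective submersion $\pi\colon M\to Q$. Then there is a unique splitting of $E$ for which there exist a closed 3-form $H_Q$ and a Riemannian metric $g_Q$ on $Q$ such that the 3-form of the splitting is $\pi^*H_Q$ and, under $E\cong TM\oplus T^*M$, $W$ is the graph $\{(u,(\pi^*g_Q)(u,\cdot))\mid u\in TM\}$. -/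

import Mathlib

open Bundle Set Manifold
open scoped Manifold ContDiff Topology

universe u

set_option linter.unusedSectionVars false

noncomputable section

namespace Courant

/-! ### Differential forms, distributions and leaves on smooth manifolds -/

section Manifolds

/-- The tangent space of a smooth `n`-manifold at `x`. -/
abbrev Tan (n : ℕ) {M : Type*} [TopologicalSpace M] [ChartedSpace (EuclideanSpace ℝ (Fin n)) M]
    (x : M) : Type := TangentSpace (𝓡 n) x

/-- Smooth vector fields on a smooth `n`-manifold. -/
abbrev SmoothVF (n : ℕ) (M : Type*) [TopologicalSpace M]
    [ChartedSpace (EuclideanSpace ℝ (Fin n)) M] [IsManifold (𝓡 n) ∞ M] : Type _ :=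
  ContMDiffSection (𝓡 n) (EuclideanSpace ℝ (Fin n)) ∞ (Tan n : M → Type)

/-- A family `x ↦ η x` of alternating `k`-linear forms on the tangent spaces. -/
abbrev Form (n : ℕ) (M : Type*) [TopologicalSpace M]
    [ChartedSpace (EuclideanSpace ℝ (Fin n)) M] (k : ℕ) : Type _ :=
  ∀ x : M, Tan n x [⋀^Fin k]→L[ℝ] ℝ

variable {n : ℕ} {M : Type*} [TopologicalSpace M] [ChartedSpace (EuclideanSpace ℝ (Fin n)) M]

/-- `η` is smooth: its values on smooth vector fields are smooth functions. -/
def Form.IsSmooth [IsManifold (𝓡 n) ∞ M] {k : ℕ} (η : Form n M k) : Prop :=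
  ∀ X : Fin k → SmoothVF n M, ContMDiff (𝓡 n) 𝓘(ℝ, ℝ) ∞ (fun x => η x (fun i => X i x))

/-- The value `(dη)(X₀, …, X_{k+1})` of the exterior derivative of a `(k+1)`-form on vector fields,
by the invariant formula
`∑ᵢ (-1)ⁱ Xᵢ(η(…, X̂ᵢ, …)) + ∑_{i<j} (-1)^{i+j} η([Xᵢ, Xⱼ], …, X̂ᵢ, …, X̂ⱼ, …)`.
The pair `(i, j)` of the second sum below stands for the pair `(i, j + 1)` of that formula, whence
the sign in front of the sum. -/
def Form.extDerivOn [IsManifold (𝓡 n) ∞ M] {k : ℕ} (η : Form n M (k + 1))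
    (X : Fin (k + 2) → SmoothVF n M) (x : M) : ℝ :=
  (∑ i : Fin (k + 2), (-1 : ℝ) ^ (i : ℕ) *
      mvfderiv (𝓡 n) (fun y : M => η y (i.removeNth (fun l => X l y))) x (X i x)) -
    ∑ i : Fin (k + 1), ∑ j ∈ Finset.Ici i, (-1 : ℝ) ^ ((i : ℕ) + (j : ℕ)) *
      η x (Matrix.vecCons (VectorField.mlieBracket (𝓡 n) (X i.castSucc) (X j.succ) x)
        (j.removeNth (i.castSucc.removeNth (fun l => X l x))))

/-- `dη = 0`. -/
def Form.IsClosed [IsManifold (𝓡 n) ∞ M] {k : ℕ} (η : Form n M (k + 1)) : Prop :=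
  ∀ (X : Fin (k + 2) → SmoothVF n M) (x : M), Form.extDerivOn η X x = 0

/-- The pullback `p^* η` of a form along a map. -/
def Form.pullback {m : ℕ} {Q : Type*} [TopologicalSpace Q]
    [ChartedSpace (EuclideanSpace ℝ (Fin m)) Q] {k : ℕ} (p : M → Q) (η : Form m Q k) :
    Form n M k :=
  fun x => (η (p x)).compContinuousLinearMap (mfderiv (𝓡 n) (𝓡 m) p x)

/-- Smooth Riemannian metrics on a smooth manifold. -/
abbrev RiemMetric (n : ℕ) (M : Type*) [TopologicalSpace M]
    [ChartedSpace (EuclideanSpace ℝ (Fin n)) M] [IsManifold (𝓡 n) ∞ M] : Type _ :=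
  ContMDiffRiemannianMetric (𝓡 n) ∞ (EuclideanSpace ℝ (Fin n)) (Tan n : M → Type)

/-- The pullback `p^* g` of a Riemannian metric, as a family of bilinear forms
`u ↦ (p^* g)(u, ·)` on the tangent spaces. -/
def RiemMetric.pullback {m : ℕ} {Q : Type*} [TopologicalSpace Q]
    [ChartedSpace (EuclideanSpace ℝ (Fin m)) Q] [IsManifold (𝓡 m) ∞ Q]
    (p : M → Q) (g : RiemMetric m Q) (x : M) : Tan n x →L[ℝ] Tan n x →L[ℝ] ℝ :=
  (ContinuousLinearMap.precomp ℝ (mfderiv (𝓡 n) (𝓡 m) p x)) ∘L (g.inner (p x)) ∘L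
    (mfderiv (𝓡 n) (𝓡 m) p x)

theorem RiemMetric.pullback_apply {m : ℕ} {Q : Type*} [TopologicalSpace Q]
    [ChartedSpace (EuclideanSpace ℝ (Fin m)) Q] [IsManifold (𝓡 m) ∞ Q]
    (p : M → Q) (g : RiemMetric m Q) (x : M) (u v : Tan n x) :
    RiemMetric.pullback p g x u v =
      g.inner (p x) (mfderiv (𝓡 n) (𝓡 m) p x u) (mfderiv (𝓡 n) (𝓡 m) p x v) := rfl

/-- `L` is a connected integral manifold of the distribution `Δ`: the image of an injective
immersion `i` of a connected manifold with `di(T_y N) = Δ_{i(y)}` for all `y`. -/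
def IsConnectedIntegralManifold {M : Type u} [TopologicalSpace M]
    [ChartedSpace (EuclideanSpace ℝ (Fin n)) M]
    (Δ : ∀ x : M, Submodule ℝ (Tan n x)) (L : Set M) : Prop :=
  ∃ (r : ℕ) (N : Type u) (_ : TopologicalSpace N) (_ : ChartedSpace (EuclideanSpace ℝ (Fin r)) N)
    (_ : IsManifold (𝓡 r) ∞ N) (_ : T2Space N) (_ : SigmaCompactSpace N) (_ : ConnectedSpace N)
    (i : N → M), ContMDiff (𝓡 r) (𝓡 n) ∞ i ∧ Function.Injective i ∧ range i = L ∧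
      ∀ y : N, Function.Injective (mfderiv (𝓡 r) (𝓡 n) i y) ∧
        (mfderiv (𝓡 r) (𝓡 n) i y).range = Δ (i y)

/-- A leaf of the distribution `Δ` is a maximal connected integral manifold. -/
def IsLeaf {M : Type u} [TopologicalSpace M] [ChartedSpace (EuclideanSpace ℝ (Fin n)) M]
    (Δ : ∀ x : M, Submodule ℝ (Tan n x)) (L : Set M) : Prop :=
  IsConnectedIntegralManifold Δ L ∧
    ∀ L' : Set M, IsConnectedIntegralManifold Δ L' → L ⊆ L' → L' = L

end Manifolds

/-! ### Exact Courant algebroids -/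

section Algebroids

variable {n : ℕ} {M : Type*} [TopologicalSpace M] [ChartedSpace (EuclideanSpace ℝ (Fin n)) M]
  [IsManifold (𝓡 n) ∞ M]
  {V : Type*} [NormedAddCommGroup V] [NormedSpace ℝ V]
  {E : M → Type*} [∀ x, AddCommGroup (E x)] [∀ x, Module ℝ (E x)]
  [TopologicalSpace (TotalSpace V E)] [∀ x, TopologicalSpace (E x)]
  [∀ x, IsTopologicalAddGroup (E x)] [∀ x, ContinuousSMul ℝ (E x)]
  [FiberBundle V E] [VectorBundle ℝ V E]

variable (n V E) in
/-- The space `Γ(E)` of smooth sections of `E`. -/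
abbrev Sec : Type _ := ContMDiffSection (𝓡 n) V ∞ E

variable (n V E) in
/-- A Courant algebroid structure on the smooth vector bundle `E → M` (with typical fibre `V`):
a nondegenerate symmetric pairing `⟨·, ·⟩`, an anchor `ρ : E → TM` and a bracket on `Γ(E)`
(the non-skew-symmetric, or Dorfman, bracket). -/
structure CourantAlgebroid where
  pairing : ∀ x, E x →L[ℝ] E x →L[ℝ] ℝ
  contMDiff_pairing : ContMDiff (𝓡 n) ((𝓡 n).prod 𝓘(ℝ, V →L[ℝ] V →L[ℝ] ℝ)) ∞
    (fun x => TotalSpace.mk' (V →L[ℝ] V →L[ℝ] ℝ) (E := fun x => E x →L[ℝ] E x →L[ℝ] ℝ)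
      x (pairing x))
  pairing_symm : ∀ x (a b : E x), pairing x a b = pairing x b a
  pairing_nondeg : ∀ x (a : E x), (∀ b, pairing x a b = 0) → a = 0
  anchor : ∀ x, E x →L[ℝ] Tan n x
  contMDiff_anchor : ContMDiff (𝓡 n) ((𝓡 n).prod 𝓘(ℝ, V →L[ℝ] EuclideanSpace ℝ (Fin n))) ∞
    (fun x => TotalSpace.mk' (V →L[ℝ] EuclideanSpace ℝ (Fin n)) (E := fun x => E x →L[ℝ] Tan n x)
      x (anchor x))
  bracket : Sec n V E →ₗ[ℝ] Sec n V E →ₗ[ℝ] Sec n V E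
  /-- `[a, [b, c]] = [[a, b], c] + [b, [a, c]]` -/
  jacobi : ∀ a b c : Sec n V E,
    bracket a (bracket b c) = bracket (bracket a b) c + bracket b (bracket a c)
  /-- `ρ[a, b] = [ρ a, ρ b]` -/
  anchor_bracket : ∀ (a b : Sec n V E) (x : M), anchor x (bracket a b x) =
    VectorField.mlieBracket (𝓡 n) (fun y => anchor y (a y)) (fun y => anchor y (b y)) x
  /-- `[a, f b] = f [a, b] + (ρ(a) f) b` -/
  leibniz : ∀ (a b fb : Sec n V E) (f : M → ℝ), ContMDiff (𝓡 n) 𝓘(ℝ, ℝ) ∞ f →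
    (∀ x, fb x = f x • b x) →
    ∀ x, bracket a fb x = f x • bracket a b x + (mvfderiv (𝓡 n) f x (anchor x (a x))) • b x
  /-- `ρ(a)⟨b, c⟩ = ⟨[a, b], c⟩ + ⟨b, [a, c]⟩` -/
  invariance : ∀ (a b c : Sec n V E) (x : M),
    mvfderiv (𝓡 n) (fun y => pairing y (b y) (c y)) x (anchor x (a x)) =
      pairing x (bracket a b x) (c x) + pairing x (b x) (bracket a c x)
  /-- `[a, b] + [b, a] = ρ^* d⟨a, b⟩` -/
  bracket_symm : ∀ (a b c : Sec n V E) (x : M),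
    pairing x (bracket a b x + bracket b a x) (c x) =
      mvfderiv (𝓡 n) (fun y => pairing y (a y) (b y)) x (anchor x (c x))

variable (V) in
theorem finiteDimensional_fibre [FiniteDimensional ℝ V] (x : M) : FiniteDimensional ℝ (E x) :=
  ((trivializationAt V E x).continuousLinearEquivAt ℝ x
    (FiberBundle.mem_baseSet_trivializationAt' x)).symm.toLinearEquiv.finiteDimensional

variable (A : CourantAlgebroid n V E)

theorem CourantAlgebroid.nondegenerate (x : M) : (A.pairing x).toBilinForm.Nondegenerate := by
  constructor
  · intro a ha
    exact A.pairing_nondeg x a ha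
  · intro a ha
    exact A.pairing_nondeg x a fun b => (A.pairing_symm x a b).trans (ha b)

/-- The map `ρ^* : T^*M → E` dual to the anchor, where `E ≅ E^*` by the pairing:
`⟨ρ^* α, e⟩ = α(ρ e)`. -/
def CourantAlgebroid.coanchor [FiniteDimensional ℝ V] (x : M) : (Tan n x →L[ℝ] ℝ) →ₗ[ℝ] E x :=
  haveI := finiteDimensional_fibre V (E := E) x
  ((A.pairing x).toBilinForm.toDual (A.nondegenerate x)).symm.toLinearMap ∘ₗ
    { toFun := fun α => (α.comp (A.anchor x)).toLinearMap
      map_add' := fun _ _ => rfl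
      map_smul' := fun _ _ => rfl }

theorem CourantAlgebroid.pairing_coanchor [FiniteDimensional ℝ V] (x : M) (α : Tan n x →L[ℝ] ℝ) (e : E x) :
    A.pairing x (A.coanchor x α) e = α (A.anchor x e) := by
  have := finiteDimensional_fibre V (E := E) x
  exact LinearMap.BilinForm.apply_toDual_symm_apply (B := (A.pairing x).toBilinForm)
    (hB := A.nondegenerate x) (α.comp (A.anchor x)).toLinearMap e

/-- `A` is exact: the sequence `0 → T^*M → E → TM → 0` with maps `ρ^*` and `ρ` is exact. -/
structure CourantAlgebroid.IsExact [FiniteDimensional ℝ V] : Prop where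
  injective : ∀ x, Function.Injective (A.coanchor x)
  exact : ∀ x, Function.Exact (A.coanchor x) (A.anchor x)
  surjective : ∀ x, Function.Surjective (A.anchor x)

/-! ### Splittings -/

/-- A splitting of an exact Courant algebroid: a smooth right inverse `TM → E` of the anchor
with isotropic image. -/
@[ext]
structure Splitting (A : CourantAlgebroid n V E) where
  toFun : ∀ x, Tan n x →L[ℝ] E x
  contMDiff_toFun : ContMDiff (𝓡 n) ((𝓡 n).prod 𝓘(ℝ, EuclideanSpace ℝ (Fin n) →L[ℝ] V)) ∞
    (fun x => TotalSpace.mk' (EuclideanSpace ℝ (Fin n) →L[ℝ] V) (E := fun x => Tan n x →L[ℝ] E x)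
      x (toFun x))
  anchor_apply : ∀ x (u : Tan n x), A.anchor x (toFun x u) = u
  isotropic : ∀ x (u v : Tan n x), A.pairing x (toFun x u) (toFun x v) = 0

variable {A}

/-- The identification `TM ⊕ T^*M → E`, `(u, α) ↦ s u + ρ^* α`, given by the splitting `s`. -/
def Splitting.toE [FiniteDimensional ℝ V] (s : Splitting A) (x : M) : (Tan n x × (Tan n x →L[ℝ] ℝ)) →ₗ[ℝ] E x :=
  (s.toFun x).toLinearMap.coprod (A.coanchor x)

theorem Splitting.toE_apply [FiniteDimensional ℝ V] (s : Splitting A) (x : M) (u : Tan n x) (α : Tan n x →L[ℝ] ℝ) :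
    s.toE x (u, α) = s.toFun x u + A.coanchor x α := rfl

theorem Splitting.bijective_toE [FiniteDimensional ℝ V] (hA : A.IsExact) (s : Splitting A) (x : M) :
    Function.Bijective (s.toE x) := by
  have h0 : ∀ α, A.anchor x (A.coanchor x α) = 0 := fun α =>
    (hA.exact x _).2 ⟨α, rfl⟩
  constructor
  · rw [← LinearMap.ker_eq_bot, LinearMap.ker_eq_bot']
    rintro ⟨u, α⟩ h
    rw [Splitting.toE_apply] at h
    have hu : u = 0 := by
      have := congrArg (A.anchor x) h
      simpa [h0, s.anchor_apply] using this
    subst hu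
    have hα : A.coanchor x α = A.coanchor x 0 := by simpa using h
    rw [hA.injective x hα]
    rfl
  · intro e
    have : A.anchor x (e - s.toFun x (A.anchor x e)) = 0 := by simp [s.anchor_apply]
    obtain ⟨α, hα⟩ := (hA.exact x _).1 this
    exact ⟨(A.anchor x e, α), by rw [Splitting.toE_apply, hα]; abel⟩

theorem Splitting.pairing_toE [FiniteDimensional ℝ V] (hA : A.IsExact) (s : Splitting A) (x : M) (u v : Tan n x)
    (α β : Tan n x →L[ℝ] ℝ) :
    A.pairing x (s.toE x (u, α)) (s.toE x (v, β)) = α v + β u := by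
  have h0 : ∀ α, A.anchor x (A.coanchor x α) = 0 := fun α =>
    (hA.exact x _).2 ⟨α, rfl⟩
  simp only [Splitting.toE_apply, map_add, add_apply, s.isotropic,
    A.pairing_coanchor, h0, s.anchor_apply, map_zero]
  rw [A.pairing_symm x (s.toFun x u), A.pairing_coanchor, s.anchor_apply]
  ring

/-- The section `s X` of `E` for a vector field `X`. -/
def Splitting.sec (s : Splitting A) (X : SmoothVF n M) : Sec n V E :=
  ⟨fun x => s.toFun x (X x), s.contMDiff_toFun.clm_bundle_apply X.contMDiff⟩

/-- `H` is the 3-form of the splitting `s`: `H(X, Y, Z) = ⟨[s X, s Y], s Z⟩`. -/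
def Splitting.HasThreeForm (s : Splitting A) (H : Form n M 3) : Prop :=
  ∀ (X Y Z : SmoothVF n M) (x : M),
    H x ![X x, Y x, Z x] = A.pairing x (A.bracket (s.sec X) (s.sec Y) x) (s.sec Z x)

/-- The graph `{(u, h(u, ·))}` of a family of bilinear forms `h`, as a family of subspaces
of the fibres of `E ≅ TM ⊕ T^*M`. -/
def Splitting.graph [FiniteDimensional ℝ V] (s : Splitting A) (h : ∀ x : M, Tan n x →L[ℝ] Tan n x →L[ℝ] ℝ) (x : M) :
    Submodule ℝ (E x) :=
  (h x).toLinearMap.graph.map (s.toE x)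

/-! ### Small Dirac structures and transverse generalized metrics -/

variable (n V) in
/-- The subspaces `S x ⊆ E x` form a smooth subbundle of `E`: they have smooth local frames. -/
def IsSubbundle (S : ∀ x : M, Submodule ℝ (E x)) : Prop :=
  ∀ x₀ : M, ∃ U : Set M, IsOpen U ∧ x₀ ∈ U ∧ ∃ (k : ℕ) (e : Fin k → ∀ x, E x),
    (∀ i, ContMDiffOn (𝓡 n) ((𝓡 n).prod 𝓘(ℝ, V)) ∞ (fun x => TotalSpace.mk' V x (e i x)) U) ∧
    ∀ x ∈ U, LinearIndependent ℝ (fun i => e i x) ∧ Submodule.span ℝ (range fun i => e i x) = S x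

variable (A)

/-- A (regular) small Dirac structure: an isotropic involutive subbundle of `E`. -/
structure IsSmallDirac (D : ∀ x : M, Submodule ℝ (E x)) : Prop where
  isSubbundle : IsSubbundle n V D
  isotropic : ∀ x, ∀ a ∈ D x, ∀ b ∈ D x, A.pairing x a b = 0
  involutive : ∀ a b : Sec n V E, (∀ x, a x ∈ D x) → (∀ x, b x ∈ D x) →
    ∀ x, A.bracket a b x ∈ D x

/-- `D` is projectable: the anchor is injective on `D`. -/
def IsProjectable (D : ∀ x : M, Submodule ℝ (E x)) : Prop :=
  ∀ x, InjOn (A.anchor x) (D x : Set (E x))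

/-- The distribution `ρ(D) ⊆ TM`. -/
def anchorImage (D : ∀ x : M, Submodule ℝ (E x)) (x : M) : Submodule ℝ (Tan n x) :=
  (D x).map (A.anchor x).toLinearMap

/-- `W` is a `D`-transverse generalized metric: a subbundle of rank `n = dim M` with
`D ⊆ W ⊆ D^⊥`, `⟨w, w⟩ > 0` for `w ∈ W \ D`, and `[Γ(D), Γ(W)] ⊆ Γ(W)`. -/
structure IsTransverseGenMetric (D W : ∀ x : M, Submodule ℝ (E x)) : Prop where
  isSubbundle : IsSubbundle n V W
  rank_eq : ∀ x, Module.finrank ℝ (W x) = n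
  le : ∀ x, D x ≤ W x
  orthogonal : ∀ x, ∀ w ∈ W x, ∀ d ∈ D x, A.pairing x w d = 0
  pos : ∀ x, ∀ w ∈ W x, w ∉ D x → 0 < A.pairing x w w
  invariant : ∀ d w : Sec n V E, (∀ x, d x ∈ D x) → (∀ x, w x ∈ W x) →
    ∀ x, A.bracket d w x ∈ W x

end Algebroids

end Courant

end

open Courant

open Courant

/-! The anchor restricts to an isomorphism W → TM. If w ∈ W and ρ w = 0, then w = ρ^*α and ⟨w, w⟩ =
α(ρ w) = 0, so positivity puts w in D, where ρ is injective; the ranks agree. Let σ be the inverse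
(`AnchorLift`). If W is the graph of a symmetric g for a splitting s, then σ u = s u + ρ^*g(u, ·);
pairing two such elements gives ⟨σ u, σ v⟩ = 2 g(u, v). Hence g = ½⟨σ·, σ·⟩ and s = σ − ½ρ^*⟨σ·, σ·⟩
are forced (`eq_splitting_of_eq_graph`), and these formulas do define an isotropic splitting with
graph W (`eq_graph`).

It remains to see that g and the 3-form of s come from Q. Let U be a vector field with values in
ρ(D). The form g is positive semidefinite with kernel ρ(D). Since [Γ(D), Γ(W)] ⊂ Γ(W) and ρ is
injective on W, [σU, σX] = σ[U, X] (`bracket_sec`), and invariance of the pairing makes the Lie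
derivative of g along U vanish. It also follows that sU = σU and [sU, sX] = s[U, X]
(`bracket_splitting_sec`). By isotropy the 3-form H is killed by contraction with U, and by the
Jacobi identity its Lie derivative along U vanishes (`mvfderiv_torsion`). That H is an alternating
tensor and closed is the usual computation from the axioms (`torsion_closed`).

Finally ρ(D) = ker dπ (`IsConnectedIntegralManifold.eq_ker`). A fibre is the image of an immersed
manifold tangent to ρ(D), which gives one inclusion; the other is a dimension count, made with
Hausdorff dimension because the immersion is not known to be open onto the fibre. So g and H are
basic for a submersion with connected fibres, and they descend (`exists_metric_descent`,
`exists_form_descent`). Closedness descends because vector fields on Q lift to M and brackets of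
lifts project to brackets. -/

noncomputable section

/-! ### Smoothness of families of linear maps and of their inverses. -/

section SmoothFamilies

variable {n : ℕ} {M : Type*} [TopologicalSpace M] [ChartedSpace (EuclideanSpace ℝ (Fin n)) M]
  {F : Type*} [NormedAddCommGroup F] [NormedSpace ℝ F]
  {G : Type*} [NormedAddCommGroup G] [NormedSpace ℝ G]

/-- A family of linear maps on a finite-dimensional space is smooth if its values are. -/
theorem contMDiffWithinAt_clm_of_apply [FiniteDimensional ℝ F] {f : M → F →L[ℝ] G} {U : Set M}
    {x : M} (h : ∀ v, ContMDiffWithinAt (𝓡 n) 𝓘(ℝ, G) ∞ (fun y => f y v) U x) :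
    ContMDiffWithinAt (𝓡 n) 𝓘(ℝ, F →L[ℝ] G) ∞ f U x := by
  let b := Module.finBasis ℝ F
  have key : f = fun y => ∑ i, ContinuousLinearMap.smulRightL ℝ F G
      (LinearMap.toContinuousLinearMap (b.coord i)) (f y (b i)) := by
    funext y
    refine ContinuousLinearMap.coe_injective (b.ext fun j => ?_)
    simp [Finsupp.single_apply, ite_smul]
  rw [key]
  refine contMDiffWithinAt_finsetSum fun i _ => ?_
  exact (ContinuousLinearMap.contMDiff
    (ContinuousLinearMap.smulRightL ℝ F G (LinearMap.toContinuousLinearMap (b.coord i))) _).comp_contMDiffWithinAt x (h (b i))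

/-- The inverse of a smooth family of invertible linear maps is smooth. -/
theorem contMDiffWithinAt_inverse_apply [CompleteSpace F] {f : M → F →L[ℝ] G} {g : M → G}
    {U : Set M} {x : M} (hf : ContMDiffWithinAt (𝓡 n) 𝓘(ℝ, F →L[ℝ] G) ∞ f U x)
    (hg : ContMDiffWithinAt (𝓡 n) 𝓘(ℝ, G) ∞ g U x) (hx : (f x).IsInvertible) :
    ContMDiffWithinAt (𝓡 n) 𝓘(ℝ, F) ∞ (fun y => (f y).inverse (g y)) U x := by
  have h := (hx.contDiffAt_map_inverse (n := ∞)).contMDiffAt.comp_contMDiffWithinAt x hf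
  exact h.clm_apply hg

end SmoothFamilies

/-! ### Extension of local sections and smoothness tests on sections. -/

section Sections

variable {n : ℕ} {M : Type*} [TopologicalSpace M] [ChartedSpace (EuclideanSpace ℝ (Fin n)) M]
  [IsManifold (𝓡 n) ∞ M] [T2Space M] [SigmaCompactSpace M]
  {V₁ : Type*} [NormedAddCommGroup V₁] [NormedSpace ℝ V₁]
  {E₁ : M → Type*} [∀ x, AddCommGroup (E₁ x)] [∀ x, Module ℝ (E₁ x)]
  [TopologicalSpace (TotalSpace V₁ E₁)] [∀ x, TopologicalSpace (E₁ x)]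
  [FiberBundle V₁ E₁] [VectorBundle ℝ V₁ E₁]

/-- A local section extends to a global one, after multiplication with a bump function. -/
theorem exists_section_eq_smul {U : Set M} (hU : IsOpen U) {x₀ : M} (hx₀ : x₀ ∈ U)
    {s : ∀ x, E₁ x}
    (hs : ContMDiffOn (𝓡 n) ((𝓡 n).prod 𝓘(ℝ, V₁)) ∞ (fun x => TotalSpace.mk' V₁ x (s x)) U) :
    ∃ (X : Sec n V₁ E₁) (f : M → ℝ), (∀ x, X x = f x • s x) ∧ (∀ᶠ x in 𝓝 x₀, f x = 1) ∧
      ∀ x ∉ U, f x = 0 := by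
  have : LocallyCompactSpace M := Manifold.locallyCompact_of_finiteDimensional (𝓡 n)
  obtain ⟨K, hK, hKU, hKc⟩ := exists_mem_nhds_isClosed_subset (hU.mem_nhds hx₀)
  obtain ⟨f, h1, h0, -⟩ := exists_contMDiffMap_one_nhds_of_subset_interior (n := ⊤) (𝓡 n)
    (isClosed_singleton (x := x₀)) (singleton_subset_iff.2 (mem_interior_iff_mem_nhds.2 hK))
  rw [nhdsSet_singleton] at h1
  have hsupp : tsupport f ⊆ U := by
    refine (closure_minimal (fun x hx => ?_) hKU).trans hKc
    exact by_contra fun h => Function.mem_support.1 hx (h0 x h)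
  refine ⟨⟨_, f.contMDiff.contMDiffOn.smul_section_of_tsupport hU hsupp hs⟩, f, fun x => rfl, h1,
    fun x hx => image_eq_zero_of_notMem_tsupport fun h => hx (hsupp h)⟩

/-- The sections that are constant in a trivialization are smooth. -/
theorem contMDiffOn_trivialization_symmL [ContMDiffVectorBundle ∞ V₁ E₁ (𝓡 n)]
    (e : Trivialization V₁ (TotalSpace.proj : TotalSpace V₁ E₁ → M)) [MemTrivializationAtlas e]
    (v : V₁) : ContMDiffOn (𝓡 n) ((𝓡 n).prod 𝓘(ℝ, V₁)) ∞
      (fun x => TotalSpace.mk' V₁ x (e.symmL ℝ x v)) e.baseSet := by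
  refine e.contMDiffOn_section_baseSet_iff.2 ((contMDiffOn_const (c := v)).congr fun y hy => ?_)
  rw [e.symmL_apply hy, e.apply_mk_symm hy]

omit [T2Space M] [SigmaCompactSpace M] [IsManifold (𝓡 n) ∞ M] in
/-- Sections of a trivial bundle are smooth iff they are smooth as functions. -/
theorem contMDiffWithinAt_trivial_iff {f : M → V₁} {U : Set M} {x : M} :
    ContMDiffWithinAt (𝓡 n) ((𝓡 n).prod 𝓘(ℝ, V₁)) ∞
      (fun x => TotalSpace.mk' V₁ (E := Bundle.Trivial M V₁) x (f x)) U x ↔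
    ContMDiffWithinAt (𝓡 n) 𝓘(ℝ, V₁) ∞ f U x := by
  rw [Bundle.contMDiffWithinAt_section]
  rfl

/-- Every vector is the value of a global smooth section. -/
theorem exists_section_apply_eq [ContMDiffVectorBundle ∞ V₁ E₁ (𝓡 n)]
    [∀ x, IsTopologicalAddGroup (E₁ x)] [∀ x, ContinuousSMul ℝ (E₁ x)]
    {x : M} (v : E₁ x) : ∃ X : Sec n V₁ E₁, X x = v := by
  let e := trivializationAt V₁ E₁ x
  have hx : x ∈ e.baseSet := FiberBundle.mem_baseSet_trivializationAt' x
  obtain ⟨X, f, hX, hf, -⟩ := exists_section_eq_smul e.open_baseSet hx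
    (contMDiffOn_trivialization_symmL (n := n) e (e.continuousLinearMapAt ℝ x v))
  refine ⟨X, ?_⟩
  rw [hX, hf.self_of_nhds, one_smul, e.symmL_continuousLinearMapAt hx]

section Hom

variable {V₂ : Type*} [NormedAddCommGroup V₂] [NormedSpace ℝ V₂]
  {E₂ : M → Type*} [∀ x, AddCommGroup (E₂ x)] [∀ x, Module ℝ (E₂ x)]
  [TopologicalSpace (TotalSpace V₂ E₂)] [∀ x, TopologicalSpace (E₂ x)]
  [FiberBundle V₂ E₂] [VectorBundle ℝ V₂ E₂]
  [∀ x, IsTopologicalAddGroup (E₂ x)] [∀ x, ContinuousSMul ℝ (E₂ x)]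

/-- A family of linear maps between the fibres of two bundles is smooth if it maps smooth sections
to smooth sections. -/
theorem contMDiff_hom_of_apply [FiniteDimensional ℝ V₁] [ContMDiffVectorBundle ∞ V₁ E₁ (𝓡 n)]
    [∀ x, IsTopologicalAddGroup (E₁ x)] [∀ x, ContinuousSMul ℝ (E₁ x)]
    {φ : ∀ x, E₁ x →L[ℝ] E₂ x}
    (h : ∀ X : Sec n V₁ E₁, ContMDiff (𝓡 n) ((𝓡 n).prod 𝓘(ℝ, V₂)) ∞
      (fun x => TotalSpace.mk' V₂ x (φ x (X x)))) :
    ContMDiff (𝓡 n) ((𝓡 n).prod 𝓘(ℝ, V₁ →L[ℝ] V₂)) ∞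
      (fun x => TotalSpace.mk' (V₁ →L[ℝ] V₂) (E := fun x => E₁ x →L[ℝ] E₂ x) x (φ x)) := by
  intro x
  refine (contMDiffAt_hom_bundle _).2 ⟨contMDiffAt_id, ?_⟩
  refine contMDiffWithinAt_clm_of_apply fun v => ?_
  let e := trivializationAt V₁ E₁ x
  have hx : x ∈ e.baseSet := FiberBundle.mem_baseSet_trivializationAt' x
  -- X equals the constant section v of the trivialization near x, so the coordinates of φ X are
  -- there the value at v of the matrix of φ.
  obtain ⟨X, f, hX, hf, -⟩ := exists_section_eq_smul e.open_baseSet hx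
    (contMDiffOn_trivialization_symmL (n := n) e v)
  refine ((contMDiffAt_section x).1 (h X x)).congr_of_eventuallyEq ?_
  filter_upwards [hf, (trivializationAt V₂ E₂ x).open_baseSet.mem_nhds
    (FiberBundle.mem_baseSet_trivializationAt' x)] with y hy hy₂
  rw [hX, hy, one_smul]
  simp [ContinuousLinearMap.inCoordinates, Trivialization.coe_linearMapAt_of_mem _ hy₂, e]

/-- If a smooth family of isomorphisms maps a section to a smooth section, then that section is
smooth. -/
theorem contMDiff_of_hom_apply [CompleteSpace V₁]
    [∀ x, IsTopologicalAddGroup (E₁ x)] [∀ x, ContinuousSMul ℝ (E₁ x)]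
    {φ : ∀ x, E₁ x →L[ℝ] E₂ x} {a : ∀ x, E₁ x}
    (hφ : ContMDiff (𝓡 n) ((𝓡 n).prod 𝓘(ℝ, V₁ →L[ℝ] V₂)) ∞
      (fun x => TotalSpace.mk' (V₁ →L[ℝ] V₂) (E := fun x => E₁ x →L[ℝ] E₂ x) x (φ x)))
    (ha : ContMDiff (𝓡 n) ((𝓡 n).prod 𝓘(ℝ, V₂)) ∞ (fun x => TotalSpace.mk' V₂ x (φ x (a x))))
    (hinv : ∀ x, (φ x).IsInvertible) :
    ContMDiff (𝓡 n) ((𝓡 n).prod 𝓘(ℝ, V₁)) ∞ (fun x => TotalSpace.mk' V₁ x (a x)) := by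
  intro x
  have h₁ := ((contMDiffAt_hom_bundle _).1 (hφ x)).2
  have h₂ := (contMDiffAt_section x).1 (ha x)
  -- In coordinates a is the inverse matrix of φ applied to φ a, and inversion is smooth.
  have key : ∀ y ∈ (trivializationAt V₁ E₁ x).baseSet ∩ (trivializationAt V₂ E₂ x).baseSet,
      (ContinuousLinearMap.inCoordinates V₁ E₁ V₂ E₂ x y x y (φ y)).IsInvertible ∧
      ContinuousLinearMap.inCoordinates V₁ E₁ V₂ E₂ x y x y (φ y)
        (trivializationAt V₁ E₁ x ⟨y, a y⟩).2 = (trivializationAt V₂ E₂ x ⟨y, φ y (a y)⟩).2 := by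
    rintro y ⟨hy₁, hy₂⟩
    obtain ⟨ψ, hψ⟩ := hinv y
    rw [ContinuousLinearMap.inCoordinates_eq hy₁ hy₂]
    refine ⟨⟨(((trivializationAt V₁ E₁ x).continuousLinearEquivAt ℝ y hy₁).symm.trans ψ).trans
      ((trivializationAt V₂ E₂ x).continuousLinearEquivAt ℝ y hy₂), ?_⟩, ?_⟩
    · rw [← hψ]; rfl
    · have : (trivializationAt V₁ E₁ x ⟨y, a y⟩).2 =
        (trivializationAt V₁ E₁ x).continuousLinearEquivAt ℝ y hy₁ (a y) := rfl
      rw [this]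
      simp only [ContinuousLinearMap.comp_apply, ContinuousLinearEquiv.coe_coe,
        ContinuousLinearEquiv.symm_apply_apply]
      rfl
  have hx := key x ⟨FiberBundle.mem_baseSet_trivializationAt' x,
    FiberBundle.mem_baseSet_trivializationAt' x⟩
  refine (contMDiffAt_section x).2 (ContMDiffWithinAt.congr_of_eventuallyEq (s := univ)
    (contMDiffWithinAt_inverse_apply h₁ h₂ hx.1) ?_ ?_)
  · rw [nhdsWithin_univ]
    filter_upwards [(trivializationAt V₁ E₁ x).open_baseSet.mem_nhds
      (FiberBundle.mem_baseSet_trivializationAt' x),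
      (trivializationAt V₂ E₂ x).open_baseSet.mem_nhds
      (FiberBundle.mem_baseSet_trivializationAt' x)] with y hy₁ hy₂
    rw [eq_comm, (key y ⟨hy₁, hy₂⟩).1.inverse_apply_eq]
    exact (key y ⟨hy₁, hy₂⟩).2.symm
  · rw [eq_comm, hx.1.inverse_apply_eq]
    exact hx.2.symm

end Hom

section Subbundle

variable {S : ∀ x : M, Submodule ℝ (E₁ x)}

/-- Every vector in a subbundle is the value of a global smooth section of the subbundle. -/
theorem Courant.IsSubbundle.exists_section_apply_eq [∀ x, IsTopologicalAddGroup (E₁ x)]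
    [∀ x, ContinuousSMul ℝ (E₁ x)] (hS : IsSubbundle n V₁ S) {x : M} {v : E₁ x}
    (hv : v ∈ S x) : ∃ X : Sec n V₁ E₁, (∀ y, X y ∈ S y) ∧ X x = v := by
  obtain ⟨U, hU, hx, k, e, he, hspan⟩ := hS x
  rw [← (hspan x hx).2, Submodule.mem_span_range_iff_exists_fun] at hv
  obtain ⟨c, rfl⟩ := hv
  obtain ⟨X, f, hX, hf, hf₀⟩ := exists_section_eq_smul (E₁ := E₁) hU hx
    (s := fun y => ∑ i, c i • e i y)
    (ContMDiffOn.sum_section fun i _ => ContMDiffOn.const_smul_section (he i))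
  refine ⟨X, fun y => ?_, by rw [hX, hf.self_of_nhds, one_smul]⟩
  rw [hX]
  by_cases hy : y ∈ U
  · rw [← (hspan y hy).2]
    exact Submodule.smul_mem _ _ (Submodule.sum_mem _ fun i _ => Submodule.smul_mem _ _
      (Submodule.subset_span ⟨i, rfl⟩))
  · rw [hf₀ y hy, zero_smul]
    exact zero_mem _

variable {V₂ : Type*} [NormedAddCommGroup V₂] [NormedSpace ℝ V₂] [FiniteDimensional ℝ V₂]
  {E₂ : M → Type*} [∀ x, AddCommGroup (E₂ x)] [∀ x, Module ℝ (E₂ x)]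
  [TopologicalSpace (TotalSpace V₂ E₂)] [∀ x, TopologicalSpace (E₂ x)]
  [FiberBundle V₂ E₂] [VectorBundle ℝ V₂ E₂]
  [∀ x, IsTopologicalAddGroup (E₂ x)] [∀ x, ContinuousSMul ℝ (E₂ x)]

/-- If a smooth family of linear maps restricts to isomorphisms on a subbundle, then its inverse
maps smooth sections to smooth sections of the subbundle. -/
theorem Courant.IsSubbundle.contMDiff_of_hom_apply [∀ x, IsTopologicalAddGroup (E₁ x)]
    [∀ x, ContinuousSMul ℝ (E₁ x)] (hS : IsSubbundle n V₁ S)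
    {φ : ∀ x, E₁ x →L[ℝ] E₂ x} {a : ∀ x, E₁ x}
    (hφ : ContMDiff (𝓡 n) ((𝓡 n).prod 𝓘(ℝ, V₁ →L[ℝ] V₂)) ∞
      (fun x => TotalSpace.mk' (V₁ →L[ℝ] V₂) (E := fun x => E₁ x →L[ℝ] E₂ x) x (φ x)))
    (ha : ContMDiff (𝓡 n) ((𝓡 n).prod 𝓘(ℝ, V₂)) ∞ (fun x => TotalSpace.mk' V₂ x (φ x (a x))))
    (haS : ∀ x, a x ∈ S x) (hinj : ∀ x, InjOn (φ x) (S x : Set (E₁ x)))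
    (hsurj : ∀ x v, ∃ b ∈ S x, φ x b = v) :
    ContMDiff (𝓡 n) ((𝓡 n).prod 𝓘(ℝ, V₁)) ∞ (fun x => TotalSpace.mk' V₁ x (a x)) := by
  intro x
  obtain ⟨U, hU, hx, k, e, he, hspan⟩ := hS x
  let t := trivializationAt V₂ E₂ x
  have hxt : x ∈ t.baseSet := FiberBundle.mem_baseSet_trivializationAt' x
  -- T is the matrix of φ restricted to S, in the local frame e of S and the trivialization t. It is
  -- invertible, and T⁻¹ applied to φ a gives the frame coefficients of a.
  let T : M → (Fin k → ℝ) →L[ℝ] V₂ := fun y =>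
    ∑ i, (ContinuousLinearMap.proj (R := ℝ) (φ := fun _ : Fin k => ℝ) i).smulRight
      (t ⟨y, φ y (e i y)⟩).2
  have hT : ∀ y ∈ t.baseSet, ∀ c, T y c = t.continuousLinearMapAt ℝ y (φ y (∑ i, c i • e i y)) := by
    intro y hy c
    simp [T, map_sum, Trivialization.coe_linearMapAt_of_mem _ hy]
  have hTinv : ∀ y ∈ U ∩ t.baseSet, (T y).IsInvertible := by
    rintro y ⟨hyU, hyt⟩
    have hmem : ∀ c : Fin k → ℝ, ∑ i, c i • e i y ∈ S y := fun c => by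
      rw [← (hspan y hyU).2]
      exact Submodule.sum_mem _ fun i _ => Submodule.smul_mem _ _
        (Submodule.subset_span ⟨i, rfl⟩)
    have hbij : Function.Bijective (T y) := by
      constructor
      · refine (injective_iff_map_eq_zero (T y)).2 fun c hc => ?_
        rw [hT y hyt] at hc
        have h₁ : φ y (∑ i, c i • e i y) = 0 := by
          have := congrArg (t.symmL ℝ y) hc
          rwa [t.symmL_continuousLinearMapAt hyt, map_zero] at this
        have h₂ : ∑ i, c i • e i y = 0 :=
          hinj y (hmem c) (zero_mem (S y)) (by rw [h₁, map_zero])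
        exact funext (Fintype.linearIndependent_iff.1 (hspan y hyU).1 c h₂)
      · intro v
        obtain ⟨b, hb, hbv⟩ := hsurj y (t.symmL ℝ y v)
        rw [← (hspan y hyU).2, Submodule.mem_span_range_iff_exists_fun] at hb
        obtain ⟨c, rfl⟩ := hb
        exact ⟨c, by rw [hT y hyt, hbv, t.continuousLinearMapAt_symmL hyt]⟩
    exact ⟨(LinearEquiv.ofBijective (T y).toLinearMap hbij).toContinuousLinearEquiv, by ext; rfl⟩
  have hTsmooth : ContMDiffWithinAt (𝓡 n) 𝓘(ℝ, (Fin k → ℝ) →L[ℝ] V₂) ∞ T U x := by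
    refine contMDiffWithinAt_clm_of_apply fun v => ?_
    have : (fun y => T y v) = fun y => ∑ i, v i • (t ⟨y, φ y (e i y)⟩).2 := by
      funext y; simp [T]
    rw [this]
    refine contMDiffWithinAt_finsetSum fun i _ => ?_
    have h : ContMDiffWithinAt (𝓡 n) 𝓘(ℝ, V₂) ∞ (fun y => (t ⟨y, φ y (e i y)⟩).2) U x :=
      Bundle.contMDiffWithinAt_section.1
        (((hφ x).contMDiffWithinAt (s := U)).clm_bundle_apply (he i x hx))
    exact (contMDiffWithinAt_const (I' := 𝓘(ℝ, ℝ)) (c := v i)).smul h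
  have hasmooth : ContMDiffWithinAt (𝓡 n) 𝓘(ℝ, V₂) ∞ (fun y => (t ⟨y, φ y (a y)⟩).2) U x :=
    Bundle.contMDiffWithinAt_section.1 (ha x).contMDiffWithinAt
  have hc := contMDiffWithinAt_inverse_apply hTsmooth hasmooth (hTinv x ⟨hx, hxt⟩)
  have hc' : ∀ i, ContMDiffWithinAt (𝓡 n) 𝓘(ℝ, ℝ) ∞
      (fun y => (T y).inverse (t ⟨y, φ y (a y)⟩).2 i) U x := fun i =>
    (ContinuousLinearMap.contMDiff (ContinuousLinearMap.proj (R := ℝ) (φ := fun _ : Fin k => ℝ) i)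
      _).comp_contMDiffWithinAt x hc
  have hsum := ContMDiffWithinAt.sum_section (s := Finset.univ)
    (fun i _ => (hc' i).smul_section (he i x hx))
  have key : ∀ y ∈ U ∩ t.baseSet,
      a y = ∑ i, (T y).inverse (t ⟨y, φ y (a y)⟩).2 i • e i y := by
    rintro y ⟨hyU, hyt⟩
    have h := haS y
    rw [← (hspan y hyU).2, Submodule.mem_span_range_iff_exists_fun] at h
    obtain ⟨c, hc⟩ := h
    have : (T y).inverse (t ⟨y, φ y (a y)⟩).2 = c := by
      rw [(hTinv y ⟨hyU, hyt⟩).inverse_apply_eq, hT y hyt, hc]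
      simp [Trivialization.coe_linearMapAt_of_mem _ hyt]
    rw [this, hc]
  refine (hsum.contMDiffAt (hU.mem_nhds hx)).congr_of_eventuallyEq ?_
  filter_upwards [hU.mem_nhds hx, t.open_baseSet.mem_nhds hxt] with y hyU hyt
  exact congrArg (TotalSpace.mk' V₁ y) (key y ⟨hyU, hyt⟩)

end Subbundle

end Sections

/-! ### Lie brackets of vector fields related by a smooth map. -/

section LieBracket

open VectorField

/-- The differential of a map preserves Lie brackets of related vector fields. -/
theorem fderiv_lieBracket_of_related {E F : Type*} [NormedAddCommGroup E] [NormedSpace ℝ E]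
    [NormedAddCommGroup F] [NormedSpace ℝ F] {f : E → F} {x : E} (hf : ContDiffAt ℝ 2 f x)
    {V W : E → E} {V' W' : F → F} (hV : DifferentiableAt ℝ V x) (hW : DifferentiableAt ℝ W x)
    (hV' : DifferentiableAt ℝ V' (f x)) (hW' : DifferentiableAt ℝ W' (f x))
    (hVV' : ∀ᶠ y in 𝓝 x, fderiv ℝ f y (V y) = V' (f y))
    (hWW' : ∀ᶠ y in 𝓝 x, fderiv ℝ f y (W y) = W' (f y)) :
    fderiv ℝ f x (lieBracket ℝ V W x) = lieBracket ℝ V' W' (f x) := by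
  have hd : DifferentiableAt ℝ f x := hf.differentiableAt two_ne_zero
  have h₁ : fderiv ℝ (fun y => fderiv ℝ f y (V y)) x = fderiv ℝ (V' ∘ f) x :=
    Filter.EventuallyEq.fderiv_eq hVV'
  have h₂ : fderiv ℝ (fun y => fderiv ℝ f y (W y)) x = fderiv ℝ (W' ∘ f) x :=
    Filter.EventuallyEq.fderiv_eq hWW'
  -- By symmetry of the second derivative, df of the bracket involves only derivatives of y ↦ df_y(V
  -- y) and y ↦ df_y(W y), which near x are V' ∘ f and W' ∘ f.
  rw [fderiv_apply_lieBracket hf (by simp) hW hV, h₁, h₂,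
    fderiv_comp x hV' hd, fderiv_comp x hW' hd]
  simp only [ContinuousLinearMap.comp_apply, hVV'.self_of_nhds, hWW'.self_of_nhds, lieBracket]

variable {n m : ℕ} {M : Type*} [TopologicalSpace M] [ChartedSpace (EuclideanSpace ℝ (Fin n)) M]
  [IsManifold (𝓡 n) ∞ M]
  {Q : Type*} [TopologicalSpace Q] [ChartedSpace (EuclideanSpace ℝ (Fin m)) Q]
  [IsManifold (𝓡 m) ∞ Q]

/-- The linear algebra behind `mfderiv_writtenInExtChartAt_related`, freed from tangent spaces. A
and S are the derivatives of the inverse charts on M and Q, C that of the chart on Q, and B is dp;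
A' is A taken within the range of the model. -/
theorem comp_inverse_apply_of_comp_eq_id {E F : Type*} [NormedAddCommGroup E] [NormedSpace ℝ E]
    [NormedAddCommGroup F] [NormedSpace ℝ F] {A A' : E →L[ℝ] E} {B : E →L[ℝ] F} {C S : F →L[ℝ] F}
    {v : E} {v' : F} (hA' : A' = A) (hA : A.IsInvertible) (hS : S.IsInvertible)
    (hSC : S.comp C = ContinuousLinearMap.id ℝ F) (hB : B v = v') :
    (C.comp (B.comp A)) (A'.inverse v) = S.inverse v' := by
  obtain ⟨A, rfl⟩ := hA
  obtain ⟨S, rfl⟩ := hS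
  subst hA' hB
  simp only [ContinuousLinearMap.inverse_equiv, ContinuousLinearMap.comp_apply,
    ContinuousLinearEquiv.coe_coe, ContinuousLinearEquiv.apply_symm_apply]
  rw [ContinuousLinearEquiv.eq_symm_apply]
  exact congrArg (fun L : F →L[ℝ] F => L (B v)) hSC

/-- Used with A and C the derivatives of the charts on M and Q, B = dp, and D the derivative of p
written in charts. -/
theorem apply_inverse_of_comp_eq {E F : Type*} [NormedAddCommGroup E] [NormedSpace ℝ E]
    [NormedAddCommGroup F] [NormedSpace ℝ F] {A : E →L[ℝ] E} {B D : E →L[ℝ] F} {C : F →L[ℝ] F}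
    {v : E} {v' : F} (hA : A.IsInvertible) (hC : C.IsInvertible)
    (h : C.comp B = D.comp A) (hD : D v = v') : B (A.inverse v) = C.inverse v' := by
  rw [eq_comm, hC.inverse_apply_eq, ← hD]
  have := congrArg (fun L : E →L[ℝ] F => L (A.inverse v)) h
  simp only [ContinuousLinearMap.comp_apply] at this
  obtain ⟨A, rfl⟩ := hA
  simpa using this.symm

/-- Relatedness survives passage to charts by the chain rule. It is needed in a whole neighbourhood
because the bracket differentiates the fields. -/
theorem mfderiv_writtenInExtChartAt_related {p : M → Q} (hp : ContMDiff (𝓡 n) (𝓡 m) ∞ p)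
    {V : ∀ x : M, Tan n x} {V' : ∀ q : Q, Tan m q}
    (hV : ∀ x, mfderiv (𝓡 n) (𝓡 m) p x (V x) = V' (p x)) (x : M) :
    ∀ᶠ y in 𝓝 (extChartAt (𝓡 n) x x), fderiv ℝ (writtenInExtChartAt (𝓡 n) (𝓡 m) x p) y
      (mpullbackWithin 𝓘(ℝ, EuclideanSpace ℝ (Fin n)) (𝓡 n) (extChartAt (𝓡 n) x).symm V
        (range (𝓡 n)) y) =
      mpullbackWithin 𝓘(ℝ, EuclideanSpace ℝ (Fin m)) (𝓡 m) (extChartAt (𝓡 m) (p x)).symm V'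
        (range (𝓡 m)) (writtenInExtChartAt (𝓡 n) (𝓡 m) x p y) := by
  have hcont : ContinuousAt (fun y => p ((extChartAt (𝓡 n) x).symm y)) (extChartAt (𝓡 n) x x) := by
    refine ContinuousAt.comp (by exact hp.continuous.continuousAt) (continuousAt_extChartAt_symm x)
  have hsrc : (extChartAt (𝓡 m) (p x)).source ∈ 𝓝 (p ((extChartAt (𝓡 n) x).symm (extChartAt (𝓡 n) x x))) := by
    rw [extChartAt_to_inv]
    exact extChartAt_source_mem_nhds _
  filter_upwards [extChartAt_target_mem_nhds (I := 𝓡 n) x, hcont hsrc] with y hy hpy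
  have hpy : p ((extChartAt (𝓡 n) x).symm y) ∈ (extChartAt (𝓡 m) (p x)).source := hpy
  set z := (extChartAt (𝓡 n) x).symm y with hz
  have hI : range (𝓡 n) = univ := by simp
  have hJ : range (𝓡 m) = univ := by simp
  have h₁ : MDifferentiableAt 𝓘(ℝ, EuclideanSpace ℝ (Fin n)) (𝓡 n) (extChartAt (𝓡 n) x).symm y := by
    have := mdifferentiableWithinAt_extChartAt_symm (I := 𝓡 n) hy
    rwa [hI, mdifferentiableWithinAt_univ] at this
  have h₃ : MDifferentiableAt (𝓡 m) 𝓘(ℝ, EuclideanSpace ℝ (Fin m)) (extChartAt (𝓡 m) (p x)) (p z) :=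
    mdifferentiableAt_extChartAt (by simpa using hpy)
  have h₂ : MDifferentiableAt (𝓡 n) (𝓡 m) p z := hp.mdifferentiableAt (by simp)
  have hF : fderiv ℝ (writtenInExtChartAt (𝓡 n) (𝓡 m) x p) y =
      (mfderiv (𝓡 m) 𝓘(ℝ, EuclideanSpace ℝ (Fin m)) (extChartAt (𝓡 m) (p x)) (p z)).comp
       ((mfderiv (𝓡 n) (𝓡 m) p z).comp
        (mfderiv 𝓘(ℝ, EuclideanSpace ℝ (Fin n)) (𝓡 n) (extChartAt (𝓡 n) x).symm y)) := by
    have h := mfderiv_comp y (I := 𝓘(ℝ, EuclideanSpace ℝ (Fin n))) (I' := 𝓡 m)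
      (I'' := 𝓘(ℝ, EuclideanSpace ℝ (Fin m))) (f := p ∘ (extChartAt (𝓡 n) x).symm) h₃
      (MDifferentiableAt.comp y h₂ h₁)
    have h' := mfderiv_comp y (I := 𝓘(ℝ, EuclideanSpace ℝ (Fin n))) (I' := 𝓡 n)
      (I'' := 𝓡 m) (f := (extChartAt (𝓡 n) x).symm) (g := p) h₂ h₁
    exact mfderiv_eq_fderiv.symm.trans (h.trans (congrArg (ContinuousLinearMap.comp _) h'))
  have hinv₁ : (mfderiv 𝓘(ℝ, EuclideanSpace ℝ (Fin n)) (𝓡 n) (extChartAt (𝓡 n) x).symm y).IsInvertible := by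
    have := isInvertible_mfderivWithin_extChartAt_symm (I := 𝓡 n) hy
    rwa [hI, mfderivWithin_univ] at this
  have hpt : (V' ((extChartAt (𝓡 m) (p x)).symm (extChartAt (𝓡 m) (p x) (p z))) :
      EuclideanSpace ℝ (Fin m)) = V' (p z) :=
    congrArg (fun q => (V' q : EuclideanSpace ℝ (Fin m))) ((extChartAt (𝓡 m) (p x)).left_inv hpy)
  have hinv₂ := isInvertible_mfderivWithin_extChartAt_symm (I := 𝓡 m)
    ((extChartAt (𝓡 m) (p x)).map_source hpy)
  have hcomp := mfderivWithin_extChartAt_symm_comp_mfderiv_extChartAt' (I := 𝓡 m) hpy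
  refine (congrArg (fun L : EuclideanSpace ℝ (Fin n) →L[ℝ] EuclideanSpace ℝ (Fin m) => L _) hF).trans ?_
  have hA : mfderivWithin 𝓘(ℝ, EuclideanSpace ℝ (Fin n)) (𝓡 n) (extChartAt (𝓡 n) x).symm
      (range (𝓡 n)) y = mfderiv 𝓘(ℝ, EuclideanSpace ℝ (Fin n)) (𝓡 n) (extChartAt (𝓡 n) x).symm y := by
    rw [hI, mfderivWithin_univ]
  exact comp_inverse_apply_of_comp_eq_id hA hinv₁ hinv₂ hcomp ((hV z).trans hpt.symm)

/-- A vector field in the preferred chart at a point. -/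
def Courant.chartRep (X : ∀ y : M, Tan n y) (x : M) :
    EuclideanSpace ℝ (Fin n) → EuclideanSpace ℝ (Fin n) :=
  mpullbackWithin 𝓘(ℝ, EuclideanSpace ℝ (Fin n)) (𝓡 n) (extChartAt (𝓡 n) x).symm X (range (𝓡 n))

theorem mlieBracket_eq_chartRep (X Y : ∀ y : M, Tan n y) (x : M) :
    mlieBracket (𝓡 n) X Y x =
      (mfderiv (𝓡 n) 𝓘(ℝ, EuclideanSpace ℝ (Fin n)) (extChartAt (𝓡 n) x) x).inverse
        (lieBracket ℝ (chartRep X x) (chartRep Y x) (extChartAt (𝓡 n) x x)) := by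
  have hI : range (𝓡 n) = univ := by simp
  have h := mlieBracketWithin_apply (I := 𝓡 n) (V := X) (W := Y) (s := univ) (x₀ := x)
  rw [preimage_univ, univ_inter] at h
  refine h.trans (congrArg _ ?_)
  exact (congrArg (fun s => lieBracketWithin ℝ (chartRep X x) (chartRep Y x) s _) hI).trans
    (congrFun lieBracketWithin_univ _)

theorem differentiableAt_chartRep (X : SmoothVF n M) (x : M) :
    DifferentiableAt ℝ (chartRep X x) (extChartAt (𝓡 n) x x) := by
  have := MDifferentiableWithinAt.differentiableWithinAt_mpullbackWithin_vectorField
    (I := 𝓡 n) (s := univ) (x := x) (V := X) X.mdifferentiableAt.mdifferentiableWithinAt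
  rw [preimage_univ, univ_inter] at this
  exact this.differentiableAt (by simp)

theorem contDiffAt_writtenInExtChartAt {p : M → Q} (hp : ContMDiff (𝓡 n) (𝓡 m) ∞ p) (x : M) :
    ContDiffAt ℝ 2 (writtenInExtChartAt (𝓡 n) (𝓡 m) x p) (extChartAt (𝓡 n) x x) := by
  have hI : range (𝓡 n) = univ := by simp
  have := (contMDiffAt_iff.1 (hp x)).2
  rw [hI, contDiffWithinAt_univ] at this
  exact this.of_le (WithTop.coe_le_coe.2 (le_top (a := (2 : ℕ∞))))

theorem mfderiv_extChartAt_comp_mfderiv {p : M → Q} (hp : ContMDiff (𝓡 n) (𝓡 m) ∞ p) (x : M) :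
    (mfderiv (𝓡 m) 𝓘(ℝ, EuclideanSpace ℝ (Fin m)) (extChartAt (𝓡 m) (p x)) (p x)).comp
      (mfderiv (𝓡 n) (𝓡 m) p x) =
    (mfderiv 𝓘(ℝ, EuclideanSpace ℝ (Fin n)) 𝓘(ℝ, EuclideanSpace ℝ (Fin m))
      (writtenInExtChartAt (𝓡 n) (𝓡 m) x p) (extChartAt (𝓡 n) x x)).comp
      (mfderiv (𝓡 n) 𝓘(ℝ, EuclideanSpace ℝ (Fin n)) (extChartAt (𝓡 n) x) x) := by
  have hΦ : MDifferentiableAt (𝓡 n) 𝓘(ℝ, EuclideanSpace ℝ (Fin n)) (extChartAt (𝓡 n) x) x :=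
    mdifferentiableAt_extChartAt (mem_chart_source _ x)
  have hΨ : MDifferentiableAt (𝓡 m) 𝓘(ℝ, EuclideanSpace ℝ (Fin m)) (extChartAt (𝓡 m) (p x)) (p x) :=
    mdifferentiableAt_extChartAt (mem_chart_source _ (p x))
  have h₁ := mfderiv_comp x (I'' := 𝓘(ℝ, EuclideanSpace ℝ (Fin m))) hΨ (hp.mdifferentiableAt (by simp))
  have h₂ := mfderiv_comp x (I' := 𝓘(ℝ, EuclideanSpace ℝ (Fin n)))
    (I'' := 𝓘(ℝ, EuclideanSpace ℝ (Fin m))) (f := extChartAt (𝓡 n) x)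
    (g := writtenInExtChartAt (𝓡 n) (𝓡 m) x p)
    ((contDiffAt_writtenInExtChartAt hp x).differentiableAt two_ne_zero).mdifferentiableAt hΦ
  have h₃ : extChartAt (𝓡 m) (p x) ∘ p =ᶠ[𝓝 x]
      writtenInExtChartAt (𝓡 n) (𝓡 m) x p ∘ extChartAt (𝓡 n) x := by
    filter_upwards [extChartAt_source_mem_nhds (I := 𝓡 n) x] with y hy
    simp only [writtenInExtChartAt, Function.comp_apply, (extChartAt (𝓡 n) x).left_inv hy]
  exact h₁.symm.trans (h₃.mfderiv_eq.trans h₂)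

/-- The differential of a smooth map preserves Lie brackets of related vector fields. -/
theorem mfderiv_mlieBracket_of_related {p : M → Q} (hp : ContMDiff (𝓡 n) (𝓡 m) ∞ p)
    {V W : SmoothVF n M} {V' W' : SmoothVF m Q}
    (hV : ∀ x, mfderiv (𝓡 n) (𝓡 m) p x (V x) = V' (p x))
    (hW : ∀ x, mfderiv (𝓡 n) (𝓡 m) p x (W x) = W' (p x)) (x : M) :
    mfderiv (𝓡 n) (𝓡 m) p x (mlieBracket (𝓡 n) V W x) = mlieBracket (𝓡 m) V' W' (p x) := by
  have hpx : writtenInExtChartAt (𝓡 n) (𝓡 m) x p (extChartAt (𝓡 n) x x) =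
      extChartAt (𝓡 m) (p x) (p x) := by
    simp [writtenInExtChartAt]
  have hF := contDiffAt_writtenInExtChartAt hp x
  have key := fderiv_lieBracket_of_related hF (differentiableAt_chartRep V x)
    (differentiableAt_chartRep W x) (V' := chartRep V' (p x)) (W' := chartRep W' (p x))
    (by rw [hpx]; exact differentiableAt_chartRep V' (p x))
    (by rw [hpx]; exact differentiableAt_chartRep W' (p x))
    (mfderiv_writtenInExtChartAt_related hp hV x) (mfderiv_writtenInExtChartAt_related hp hW x)
  rw [hpx, ← mfderiv_eq_fderiv] at key
  have h₄ := mfderiv_extChartAt_comp_mfderiv hp x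
  rw [mlieBracket_eq_chartRep, mlieBracket_eq_chartRep]
  exact apply_inverse_of_comp_eq (E := EuclideanSpace ℝ (Fin n)) (F := EuclideanSpace ℝ (Fin m))
    (A := mfderiv (𝓡 n) 𝓘(ℝ, EuclideanSpace ℝ (Fin n)) (extChartAt (𝓡 n) x) x)
    (B := mfderiv (𝓡 n) (𝓡 m) p x)
    (C := mfderiv (𝓡 m) 𝓘(ℝ, EuclideanSpace ℝ (Fin m)) (extChartAt (𝓡 m) (p x)) (p x))
    (v := lieBracket ℝ (chartRep V x) (chartRep W x) (extChartAt (𝓡 n) x x))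
    (v' := lieBracket ℝ (chartRep V' (p x)) (chartRep W' (p x)) (extChartAt (𝓡 m) (p x) (p x)))
    (isInvertible_mfderiv_extChartAt (mem_extChartAt_source x))
    (isInvertible_mfderiv_extChartAt (mem_extChartAt_source (p x))) h₄ key

end LieBracket

/-! ### Local sections and fibre charts of submersions. -/

section Submersions

variable {n m : ℕ} {M : Type*} [TopologicalSpace M] [ChartedSpace (EuclideanSpace ℝ (Fin n)) M]
  [IsManifold (𝓡 n) ∞ M]
  {Q : Type*} [TopologicalSpace Q] [ChartedSpace (EuclideanSpace ℝ (Fin m)) Q]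
  [IsManifold (𝓡 m) ∞ Q] {p : M → Q}

/-- A submersion has a smooth local section through every point. -/
theorem Manifold.IsSubmersionAt.exists_local_section {x : M}
    (hp : IsSubmersionAt (𝓡 n) (𝓡 m) ∞ p x) :
    ∃ (U : Set Q) (τ : Q → M), IsOpen U ∧ p x ∈ U ∧ ContMDiffOn (𝓡 m) (𝓡 n) ∞ τ U ∧
      τ (p x) = x ∧ ∀ q ∈ U, p (τ q) = q := by
  obtain ⟨F, _, _, h⟩ := hp
  set φ := h.domChart.extend (𝓡 n) with hφ
  set ψ := h.codChart.extend (𝓡 m) with hψ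
  have hxφ : x ∈ φ.source := by rw [hφ, OpenPartialHomeomorph.extend_source]; exact h.mem_domChart_source
  have hxψ : p x ∈ ψ.source := by rw [hψ, OpenPartialHomeomorph.extend_source]; exact h.mem_codChart_source
  have hφo : IsOpen φ.target := h.domChart.isOpen_extend_target
  have hψo : IsOpen ψ.source := h.codChart.isOpen_extend_source
  -- In adapted charts p is the projection to the first factor; ι is the horizontal slice through φ
  -- x, on which p is inverted.
  let ι : EuclideanSpace ℝ (Fin m) → EuclideanSpace ℝ (Fin n) := fun v =>
    h.equiv.symm (v, (h.equiv (φ x)).2)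
  have hι : ContDiff ℝ ∞ ι :=
    h.equiv.symm.contDiff.comp (contDiff_id.prodMk contDiff_const)
  have hψs : ContMDiffOn (𝓡 m) 𝓘(ℝ, EuclideanSpace ℝ (Fin m)) ∞ ψ ψ.source := by
    rw [hψ, OpenPartialHomeomorph.extend_source]
    exact OpenPartialHomeomorph.contMDiffOn_extend h.codChart_mem_maximalAtlas
  have hφs : ContMDiffOn 𝓘(ℝ, EuclideanSpace ℝ (Fin n)) (𝓡 n) ∞ φ.symm φ.target := by
    rw [hφ, OpenPartialHomeomorph.extend_target']
    exact contMDiffOn_extend_symm h.domChart_mem_maximalAtlas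
  have hw : ∀ y ∈ φ.target, ψ (p (φ.symm y)) = (h.equiv y).1 := fun y hy => h.writtenInCharts hy
  have hιx : ι (ψ (p x)) = φ x := by
    have := hw (φ x) (φ.map_source hxφ)
    rw [φ.left_inv hxφ] at this
    simp only [ι, this, Prod.mk.eta, ContinuousLinearEquiv.symm_apply_apply]
  have hcont : ContinuousOn (fun q => ι (ψ q)) ψ.source :=
    hι.continuous.comp_continuousOn hψs.continuousOn
  refine ⟨ψ.source ∩ (fun q => ι (ψ q)) ⁻¹' φ.target, fun q => φ.symm (ι (ψ q)),
    hcont.isOpen_inter_preimage hψo hφo, ⟨hxψ, ?_⟩, ?_, ?_, ?_⟩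
  · rw [mem_preimage, hιx]
    exact φ.map_source hxφ
  · refine hφs.comp ((hι.contMDiff.comp_contMDiffOn hψs).mono inter_subset_left) inter_subset_right
  · simp only [hιx, φ.left_inv hxφ]
  · rintro q ⟨hq, hq'⟩
    have h₁ := hw _ hq'
    simp only [ι, ContinuousLinearEquiv.apply_symm_apply] at h₁
    refine ψ.injOn ?_ hq h₁
    have h₂ : φ.symm (ι (ψ q)) ∈ h.domChart.source := by
      rw [← OpenPartialHomeomorph.extend_source (I := 𝓡 n)]
      exact φ.map_target hq'
    rw [hψ, OpenPartialHomeomorph.extend_source]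
    exact h.source_subset_preimage_source h₂

/-- Near every point, the fibre of a submersion is parametrized by an open subset of a vector space
of dimension `dim M - dim Q`. -/
theorem Manifold.IsSubmersionAt.exists_fibre_chart {x : M} (hp : IsSubmersionAt (𝓡 n) (𝓡 m) ∞ p x) :
    ∃ (F : Type) (_ : NormedAddCommGroup F) (_ : NormedSpace ℝ F) (_ : FiniteDimensional ℝ F)
      (c : M → F) (O : Set M), m + Module.finrank ℝ F = n ∧ IsOpen O ∧ x ∈ O ∧
      ContMDiffOn (𝓡 n) 𝓘(ℝ, F) ∞ c O ∧ c '' (O ∩ p ⁻¹' {p x}) ∈ 𝓝 (c x) := by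
  obtain ⟨F, _, _, h⟩ := hp
  set φ := h.domChart.extend (𝓡 n) with hφ
  set ψ := h.codChart.extend (𝓡 m) with hψ
  have hxφ : x ∈ φ.source := by rw [hφ, OpenPartialHomeomorph.extend_source]; exact h.mem_domChart_source
  have hxψ : p x ∈ ψ.source := by rw [hψ, OpenPartialHomeomorph.extend_source]; exact h.mem_codChart_source
  have hφo : IsOpen φ.target := h.domChart.isOpen_extend_target
  have hw : ∀ y ∈ φ.target, ψ (p (φ.symm y)) = (h.equiv y).1 := fun y hy => h.writtenInCharts hy
  have hφs : ContMDiffOn (𝓡 n) 𝓘(ℝ, EuclideanSpace ℝ (Fin n)) ∞ φ φ.source := by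
    rw [hφ, OpenPartialHomeomorph.extend_source]
    exact OpenPartialHomeomorph.contMDiffOn_extend h.domChart_mem_maximalAtlas
  have hfd : FiniteDimensional ℝ (EuclideanSpace ℝ (Fin m) × F) :=
    h.equiv.toLinearEquiv.finiteDimensional
  have hF : FiniteDimensional ℝ F :=
    FiniteDimensional.of_surjective (LinearMap.snd ℝ (EuclideanSpace ℝ (Fin m)) F) Prod.snd_surjective
  -- The vertical slice through φ x: its first coordinate is fixed, so it stays in one fibre, and
  -- its second coordinate is the chart of that fibre.
  let κ : F → EuclideanSpace ℝ (Fin n) := fun z => h.equiv.symm ((h.equiv (φ x)).1, z)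
  have hκ : Continuous κ := h.equiv.symm.continuous.comp (continuous_const.prodMk continuous_id)
  have hκx : κ (h.equiv (φ x)).2 = φ x := by simp [κ]
  refine ⟨F, _, _, hF, fun y => (h.equiv (φ y)).2, φ.source, ?_, h.domChart.isOpen_extend_source,
    hxφ, ?_, ?_⟩
  · have := h.equiv.toLinearEquiv.finrank_eq
    rw [Module.finrank_prod, finrank_euclideanSpace_fin, finrank_euclideanSpace_fin] at this
    exact this.symm
  · exact ((contDiff_snd.comp h.equiv.contDiff).contMDiff).comp_contMDiffOn hφs
  · have hnhds : κ ⁻¹' φ.target ∈ 𝓝 (h.equiv (φ x)).2 :=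
      hκ.continuousAt.preimage_mem_nhds (by rw [hκx]; exact hφo.mem_nhds (φ.map_source hxφ))
    refine Filter.mem_of_superset hnhds fun z hz => ?_
    have hz : κ z ∈ φ.target := hz
    refine ⟨φ.symm (κ z), ⟨φ.map_target hz, ?_⟩, ?_⟩
    · have h₁ := hw _ hz
      have h₂ := hw _ (φ.map_source hxφ)
      rw [φ.left_inv hxφ] at h₂
      simp only [κ, ContinuousLinearEquiv.apply_symm_apply] at h₁
      refine ψ.injOn ?_ hxψ (h₁.trans h₂.symm)
      have h₃ : φ.symm (κ z) ∈ h.domChart.source := by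
        rw [← OpenPartialHomeomorph.extend_source (I := 𝓡 n)]
        exact φ.map_target hz
      rw [hψ, OpenPartialHomeomorph.extend_source]
      exact h.source_subset_preimage_source h₃
    · simp only [φ.right_inv hz, κ, ContinuousLinearEquiv.apply_symm_apply]

/-- The differential of a submersion is surjective. -/
theorem Manifold.IsSubmersionAt.mfderiv_surjective {x : M} (hp : IsSubmersionAt (𝓡 n) (𝓡 m) ∞ p x) :
    Function.Surjective (mfderiv (𝓡 n) (𝓡 m) p x) := by
  obtain ⟨U, τ, hU, hx, hτ, hτx, hpτ⟩ := hp.exists_local_section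
  intro v
  have h₁ : MDifferentiableAt (𝓡 m) (𝓡 n) τ (p x) :=
    ((hτ (p x) hx).contMDiffAt (hU.mem_nhds hx)).mdifferentiableAt (by simp)
  have h₂ : MDifferentiableAt (𝓡 n) (𝓡 m) p x := hp.contMDiffAt.mdifferentiableAt (by simp)
  have h₃ : p ∘ τ =ᶠ[𝓝 (p x)] id := by
    filter_upwards [hU.mem_nhds hx] with q hq using hpτ q hq
  have h₄ := mfderiv_comp_of_eq (I := 𝓡 m) (I' := 𝓡 n) (I'' := 𝓡 m) h₂ h₁ hτx
  rw [h₃.mfderiv_eq, mfderiv_id] at h₄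
  have h₅ : ∀ y, y = x → ∀ w : EuclideanSpace ℝ (Fin n),
      (mfderiv (𝓡 n) (𝓡 m) p y w : EuclideanSpace ℝ (Fin m)) = mfderiv (𝓡 n) (𝓡 m) p x w := by
    rintro _ rfl w
    rfl
  refine ⟨mfderiv (𝓡 m) (𝓡 n) τ (p x) v, ?_⟩
  have h₆ := congrArg (fun L : EuclideanSpace ℝ (Fin m) →L[ℝ] EuclideanSpace ℝ (Fin m) => L v) h₄
  exact (h₅ _ hτx _).symm.trans h₆.symm

/-- A function on the base of a surjective submersion is smooth if its pullback is. -/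
theorem contMDiff_of_comp_submersion (hp : IsSubmersion (𝓡 n) (𝓡 m) ∞ p)
    (hsurj : Function.Surjective p) {f : Q → ℝ}
    (hf : ContMDiff (𝓡 n) 𝓘(ℝ, ℝ) ∞ (f ∘ p)) : ContMDiff (𝓡 m) 𝓘(ℝ, ℝ) ∞ f := by
  intro q
  obtain ⟨x, rfl⟩ := hsurj q
  obtain ⟨U, τ, hU, hx, hτ, hτx, hpτ⟩ := (hp.isSubmersionAt x).exists_local_section
  refine ((hf.comp_contMDiffOn hτ).contMDiffAt (hU.mem_nhds hx)).congr_of_eventuallyEq ?_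
  filter_upwards [hU.mem_nhds hx] with q hq
  simp [hpτ q hq]

end Submersions

/-! ### Lifts of vector fields; functions with zero differential; Hausdorff dimension of smooth
images. -/

section Lifts

variable {n m : ℕ} {M : Type*} [TopologicalSpace M] [ChartedSpace (EuclideanSpace ℝ (Fin n)) M]
  [IsManifold (𝓡 n) ∞ M] [T2Space M] [SigmaCompactSpace M]
  {Q : Type*} [TopologicalSpace Q] [ChartedSpace (EuclideanSpace ℝ (Fin m)) Q]
  [IsManifold (𝓡 m) ∞ Q] {p : M → Q}

/-- Locally, vector fields lift along a smooth map with surjective differential. -/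
theorem exists_local_lift (hp : ContMDiff (𝓡 n) (𝓡 m) ∞ p) {x₀ : M}
    (hsurj : Function.Surjective (mfderiv (𝓡 n) (𝓡 m) p x₀)) (X : SmoothVF m Q) :
    ∃ U ∈ 𝓝 x₀, ∃ Y : ∀ x : M, Tan n x,
      ContMDiffOn (𝓡 n) ((𝓡 n).prod 𝓘(ℝ, EuclideanSpace ℝ (Fin n))) ∞
        (fun x => TotalSpace.mk' (EuclideanSpace ℝ (Fin n)) x (Y x)) U ∧
      ∀ x ∈ U, mfderiv (𝓡 n) (𝓡 m) p x (Y x) = X (p x) := by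
  let e := trivializationAt (EuclideanSpace ℝ (Fin n)) (TangentSpace (𝓡 n) : M → Type) x₀
  let e' := trivializationAt (EuclideanSpace ℝ (Fin m)) (TangentSpace (𝓡 m) : Q → Type) (p x₀)
  have he : x₀ ∈ e.baseSet := FiberBundle.mem_baseSet_trivializationAt' x₀
  have he' : p x₀ ∈ e'.baseSet := FiberBundle.mem_baseSet_trivializationAt' (p x₀)
  let O : Set M := e.baseSet ∩ p ⁻¹' e'.baseSet
  have hO : IsOpen O := e.open_baseSet.inter (e'.open_baseSet.preimage hp.continuous)
  let S : M → EuclideanSpace ℝ (Fin n) →L[ℝ] EuclideanSpace ℝ (Fin m) := fun x =>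
    (e'.continuousLinearMapAt ℝ (p x)).comp ((mfderiv (𝓡 n) (𝓡 m) p x).comp (e.symmL ℝ x))
  have hSsurj : Function.Surjective (S x₀) := by
    intro v
    obtain ⟨w, hw⟩ := hsurj (e'.symmL ℝ (p x₀) v)
    refine ⟨e.continuousLinearMapAt ℝ x₀ w, ?_⟩
    change e'.continuousLinearMapAt ℝ (p x₀) (mfderiv (𝓡 n) (𝓡 m) p x₀
      (e.symmL ℝ x₀ (e.continuousLinearMapAt ℝ x₀ w))) = v
    rw [e.symmL_continuousLinearMapAt he, hw, e'.continuousLinearMapAt_symmL he']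
  obtain ⟨R, hR⟩ := (S x₀).toLinearMap.exists_rightInverse_of_surjective
    (LinearMap.range_eq_top.2 hSsurj)
  let R' : EuclideanSpace ℝ (Fin m) →L[ℝ] EuclideanSpace ℝ (Fin n) := LinearMap.toContinuousLinearMap R
  -- S is dp in trivializations and R' a right inverse of it at x₀ only. T = S ∘ R' is the identity
  -- at x₀, hence invertible nearby, and R' ∘ T⁻¹ is a smooth right inverse of S there.
  let T : M → EuclideanSpace ℝ (Fin m) →L[ℝ] EuclideanSpace ℝ (Fin m) := fun x => (S x).comp R'
  have hT : ContMDiffOn (𝓡 n) 𝓘(ℝ, EuclideanSpace ℝ (Fin m) →L[ℝ] EuclideanSpace ℝ (Fin m)) ∞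
      T O := by
    intro x hx
    refine contMDiffWithinAt_clm_of_apply fun v => ?_
    have h₁ : ContMDiffOn (𝓡 n) (𝓡 m).tangent ∞ (fun x : M =>
        tangentMap (𝓡 n) (𝓡 m) p ⟨x, e.symmL ℝ x (R' v)⟩) O :=
      (hp.contMDiff_tangentMap (m := ∞) (by simp)).comp_contMDiffOn
        ((contMDiffOn_trivialization_symmL (n := n) e (R' v)).mono inter_subset_left)
    have h₂ : ContMDiffWithinAt (𝓡 n) 𝓘(ℝ, EuclideanSpace ℝ (Fin m)) ∞ (fun x : M =>
        (e' (tangentMap (𝓡 n) (𝓡 m) p ⟨x, e.symmL ℝ x (R' v)⟩)).2) O x :=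
      ((e'.contMDiffWithinAt_iff (f := fun x : M =>
        tangentMap (𝓡 n) (𝓡 m) p ⟨x, e.symmL ℝ x (R' v)⟩) (e'.mem_source.2 hx.2)).1 (h₁ x hx)).2
    refine h₂.congr (fun y hy => ?_) ?_
    · exact e'.continuousLinearMapAt_apply_of_mem ℝ hy.2 _
    · exact e'.continuousLinearMapAt_apply_of_mem ℝ hx.2 _
  have hT₀ : T x₀ = ContinuousLinearMap.id ℝ _ := by
    ext1 v
    exact congrArg (fun L : _ →ₗ[ℝ] _ => L v) hR
  let c : M → EuclideanSpace ℝ (Fin m) := fun x =>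
    (T x).inverse (e'.continuousLinearMapAt ℝ (p x) (X (p x)))
  have hopen : IsOpen (O ∩ T ⁻¹' {L | L.IsInvertible}) :=
    hT.continuousOn.isOpen_inter_preimage hO ContinuousLinearEquiv.isOpen
  have hx₀ : x₀ ∈ O ∩ T ⁻¹' {L | L.IsInvertible} :=
    ⟨⟨he, he'⟩, ContinuousLinearEquiv.refl ℝ _, by rw [hT₀]; rfl⟩
  have hc : ContMDiffOn (𝓡 n) 𝓘(ℝ, EuclideanSpace ℝ (Fin m)) ∞ c
      (O ∩ T ⁻¹' {L | L.IsInvertible}) := by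
    rintro x ⟨hx, hTx⟩
    refine contMDiffWithinAt_inverse_apply ((hT x hx).mono inter_subset_left) ?_ hTx
    have h₁ : ContMDiff (𝓡 n) (𝓡 m).tangent ∞ (fun x : M =>
        (⟨p x, X (p x)⟩ : TangentBundle (𝓡 m) Q)) := X.contMDiff.comp hp
    refine ((e'.contMDiffWithinAt_iff (f := fun x : M =>
        (⟨p x, X (p x)⟩ : TangentBundle (𝓡 m) Q)) (e'.mem_source.2 hx.2)).1
      (h₁ x).contMDiffWithinAt).2.congr (fun y hy => ?_) ?_
    · exact e'.continuousLinearMapAt_apply_of_mem ℝ hy.1.2 _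
    · exact e'.continuousLinearMapAt_apply_of_mem ℝ hx.2 _
  refine ⟨_, hopen.mem_nhds hx₀, fun x => e.symmL ℝ x (R' (c x)), ?_, ?_⟩
  · refine (e.contMDiffOn_section_iff hopen (fun x hx => hx.1.1)).2 ?_
    refine (R'.contMDiff.comp_contMDiffOn hc).congr fun x hx => ?_
    rw [e.symmL_apply hx.1.1, e.apply_mk_symm hx.1.1]
    rfl
  · rintro x ⟨hx, hTx⟩
    have h₁ : T x (c x) = e'.continuousLinearMapAt ℝ (p x) (X (p x)) := hTx.self_apply_inverse _
    have h₂ := congrArg (e'.symmL ℝ (p x)) h₁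
    rw [e'.symmL_continuousLinearMapAt hx.2] at h₂
    rw [← h₂]
    exact (e'.symmL_continuousLinearMapAt hx.2 _).symm

/-- Vector fields lift along a submersion. -/
theorem exists_lift (hp : IsSubmersion (𝓡 n) (𝓡 m) ∞ p) (X : SmoothVF m Q) :
    ∃ Y : SmoothVF n M, ∀ x, mfderiv (𝓡 n) (𝓡 m) p x (Y x) = X (p x) := by
  -- The lifts of a vector form an affine, hence convex, subspace, so local lifts are glued by a
  -- partition of unity.
  refine exists_contMDiffSection_forall_mem_convex_of_local (𝓡 n) (n := ⊤)
    (Tan n : M → Type) (fun x => {v | mfderiv (𝓡 n) (𝓡 m) p x v = X (p x)}) (fun x => ?_)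
    fun x₀ => exists_local_lift hp.contMDiff (hp.isSubmersionAt x₀).mfderiv_surjective X
  intro v hv w hw a b _ _ hab
  have hv : mfderiv (𝓡 n) (𝓡 m) p x v = X (p x) := hv
  have hw : mfderiv (𝓡 n) (𝓡 m) p x w = X (p x) := hw
  change mfderiv (𝓡 n) (𝓡 m) p x (a • v + b • w) = X (p x)
  rw [map_add, map_smul, map_smul, hv, hw, ← add_smul, hab, one_smul]

/-- A function with zero differential on a connected manifold is constant. -/
theorem eq_of_mfderiv_eq_zero {r : ℕ} {N : Type*} [TopologicalSpace N]
    [ChartedSpace (EuclideanSpace ℝ (Fin r)) N] [IsManifold (𝓡 r) ∞ N] [ConnectedSpace N]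
    {f : N → ℝ} (hf : ContMDiff (𝓡 r) 𝓘(ℝ, ℝ) ∞ f)
    (h : ∀ y, mfderiv (𝓡 r) 𝓘(ℝ, ℝ) f y = 0) (y z : N) : f y = f z := by
  refine IsLocallyConstant.apply_eq_of_preconnectedSpace ?_ y z
  refine (IsLocallyConstant.iff_eventually_eq f).2 fun x => ?_
  let e := extChartAt (𝓡 r) x
  obtain ⟨ε, hε, hball⟩ := Metric.isOpen_iff.1 (isOpen_extChartAt_target (I := 𝓡 r) x) (e x)
    (mem_extChartAt_target x)
  have hderiv : ∀ v ∈ Metric.ball (e x) ε, HasFDerivAt (f ∘ e.symm)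
      (0 : EuclideanSpace ℝ (Fin r) →L[ℝ] ℝ) v := by
    intro v hv
    have h₁ : MDifferentiableAt 𝓘(ℝ, EuclideanSpace ℝ (Fin r)) (𝓡 r) e.symm v := by
      have := mdifferentiableWithinAt_extChartAt_symm (I := 𝓡 r) (hball hv)
      rwa [show range (𝓡 r) = univ by simp, mdifferentiableWithinAt_univ] at this
    have h₂ := ((hf.mdifferentiableAt (by simp)).hasMFDerivAt (x := e.symm v)).comp v h₁.hasMFDerivAt
    rw [h (e.symm v)] at h₂
    have h₃ := h₂.hasFDerivAt
    exact h₃.congr_fderiv (ContinuousLinearMap.zero_comp _)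
  filter_upwards [extChartAt_source_mem_nhds (I := 𝓡 r) x,
    (continuousAt_extChartAt (I := 𝓡 r) x).preimage_mem_nhds (Metric.ball_mem_nhds _ hε)]
    with y hy hy'
  have key := (convex_ball (e x) ε).is_const_of_fderivWithin_eq_zero (𝕜 := ℝ) (f := f ∘ e.symm)
    (fun v hv => (hderiv v hv).differentiableAt.differentiableWithinAt)
    (fun v hv => (hderiv v hv).hasFDerivWithinAt.fderivWithin
      (Metric.isOpen_ball.uniqueDiffWithinAt hv)) hy' (Metric.mem_ball_self hε)
  simpa only [Function.comp_apply, e, (extChartAt (𝓡 r) x).left_inv hy, extChartAt_to_inv] using key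

open MeasureTheory in
/-- The Hausdorff dimension of the smooth image of an open subset of a manifold is at most the
dimension of the manifold. -/
theorem dimH_image_le_of_contMDiffOn {r : ℕ} {N : Type*} [TopologicalSpace N]
    [ChartedSpace (EuclideanSpace ℝ (Fin r)) N] [IsManifold (𝓡 r) ∞ N] [SigmaCompactSpace N]
    {F : Type*} [NormedAddCommGroup F] [NormedSpace ℝ F] {f : N → F} {O : Set N} (hO : IsOpen O)
    (hf : ContMDiffOn (𝓡 r) 𝓘(ℝ, F) ∞ f O) : dimH (f '' O) ≤ r := by
  have := ChartedSpace.secondCountable_of_sigmaCompact (EuclideanSpace ℝ (Fin r)) N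
  -- In charts f is locally Lipschitz and so does not raise Hausdorff dimension; second countability
  -- then reduces the image to a countable union of such pieces.
  have hloc : ∀ y ∈ O, ∃ t ∈ 𝓝[O] y, dimH (f '' t) ≤ r := by
    intro y hy
    have h₁ := ((contMDiffAt_iff.1 ((hf y hy).contMDiffAt (hO.mem_nhds hy))).2)
    rw [show range (𝓡 r) = univ by simp, contDiffWithinAt_univ] at h₁
    obtain ⟨K, t, ht, hK⟩ := (h₁.of_le (m := 1) (by simp)).exists_lipschitzOnWith
    refine ⟨(extChartAt (𝓡 r) y).source ∩ extChartAt (𝓡 r) y ⁻¹' t,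
      mem_nhdsWithin_of_mem_nhds (Filter.inter_mem (extChartAt_source_mem_nhds y)
        ((continuousAt_extChartAt y).preimage_mem_nhds ht)), ?_⟩
    refine (dimH_mono (t := (extChartAt 𝓘(ℝ, F) (f y) ∘ f ∘ (extChartAt (𝓡 r) y).symm) '' t) ?_).trans
      (hK.dimH_image_le.trans ((dimH_mono (subset_univ t)).trans ?_))
    · rintro _ ⟨z, ⟨hz, hzt⟩, rfl⟩
      exact ⟨_, hzt, congrArg f ((extChartAt (𝓡 r) y).left_inv hz)⟩
    · rw [Real.dimH_univ_eq_finrank, finrank_euclideanSpace_fin]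
  choose! t ht hdim using hloc
  obtain ⟨S, hSO, hS, hcover⟩ := TopologicalSpace.countable_cover_nhdsWithin ht
  calc dimH (f '' O) ≤ dimH (⋃ y ∈ S, f '' t y) := by
        refine dimH_mono ?_
        rw [← image_iUnion₂]
        exact image_mono hcover
    _ ≤ r := by
        rw [dimH_bUnion hS]
        exact iSup₂_le fun y hy => hdim y (hSO hy)

end Lifts

/-! ### Exact Courant algebroids: smoothness tests by pairing, and the inverse of the anchor on W.
-/

namespace Courant

section Tangent

variable {n : ℕ} {M : Type*} [TopologicalSpace M] [ChartedSpace (EuclideanSpace ℝ (Fin n)) M]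

instance (x : M) : FiniteDimensional ℝ (Tan n x) :=
  inferInstanceAs (FiniteDimensional ℝ (EuclideanSpace ℝ (Fin n)))

instance (x : M) : T2Space (Tan n x) :=
  inferInstanceAs (T2Space (EuclideanSpace ℝ (Fin n)))

theorem finrank_tan (x : M) : Module.finrank ℝ (Tan n x) = n :=
  finrank_euclideanSpace_fin (𝕜 := ℝ) (n := n)

end Tangent

variable {n : ℕ} {M : Type*} [TopologicalSpace M] [ChartedSpace (EuclideanSpace ℝ (Fin n)) M]
  [IsManifold (𝓡 n) ∞ M] [T2Space M] [SigmaCompactSpace M]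
  {V : Type*} [NormedAddCommGroup V] [NormedSpace ℝ V] [FiniteDimensional ℝ V]
  {E : M → Type*} [∀ x, AddCommGroup (E x)] [∀ x, Module ℝ (E x)]
  [TopologicalSpace (TotalSpace V E)] [∀ x, TopologicalSpace (E x)]
  [∀ x, IsTopologicalAddGroup (E x)] [∀ x, ContinuousSMul ℝ (E x)]
  [FiberBundle V E] [VectorBundle ℝ V E] [ContMDiffVectorBundle ∞ V E (𝓡 n)]
  {A : CourantAlgebroid n V E}

theorem contMDiff_scalar_iff {f : M → ℝ} :
    ContMDiff (𝓡 n) ((𝓡 n).prod 𝓘(ℝ, ℝ)) ∞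
      (fun x => TotalSpace.mk' ℝ (E := Bundle.Trivial M ℝ) x (f x)) ↔
    ContMDiff (𝓡 n) 𝓘(ℝ, ℝ) ∞ f := by
  constructor <;> intro h x
  · exact contMDiffWithinAt_trivial_iff.1 (h x)
  · exact contMDiffWithinAt_trivial_iff.2 (h x)

variable (A) in
theorem CourantAlgebroid.contMDiff_pairing_apply (a b : Sec n V E) :
    ContMDiff (𝓡 n) 𝓘(ℝ, ℝ) ∞ (fun x => A.pairing x (a x) (b x)) :=
  contMDiff_scalar_iff.1 ((A.contMDiff_pairing.clm_bundle_apply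
    (E₂ := fun x => E x →L[ℝ] (Bundle.Trivial M ℝ x)) a.contMDiff).clm_bundle_apply b.contMDiff)

variable (A) in
/-- The vector field `ρ a` of a section `a`. -/
def CourantAlgebroid.anchorSec (a : Sec n V E) : SmoothVF n M :=
  ⟨fun x => A.anchor x (a x), A.contMDiff_anchor.clm_bundle_apply a.contMDiff⟩

variable (A) in
theorem CourantAlgebroid.isInvertible_pairing (x : M) : (A.pairing x).IsInvertible := by
  have := finiteDimensional_fibre V (E := E) x
  have : T2Space (E x) := ((trivializationAt V E x).continuousLinearEquivAt ℝ x
    (FiberBundle.mem_baseSet_trivializationAt' x)).toHomeomorph.symm.t2Space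
  have hinj : Function.Injective (A.pairing x).toLinearMap := by
    refine (injective_iff_map_eq_zero _).2 fun a ha => A.pairing_nondeg x a fun b => ?_
    exact congrArg (fun L : E x →L[ℝ] ℝ => L b) ha
  have hsurj : Function.Surjective (A.pairing x).toLinearMap := by
    refine (LinearMap.injective_iff_surjective_of_finrank_eq_finrank ?_).1 hinj
    rw [← (LinearMap.toContinuousLinearMap : (E x →ₗ[ℝ] ℝ) ≃ₗ[ℝ] _).finrank_eq]
    exact Subspace.dual_finrank_eq.symm
  exact ⟨(LinearEquiv.ofBijective _ ⟨hinj, hsurj⟩).toContinuousLinearEquiv, by ext; rfl⟩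

variable (A) in
/-- A section of a Courant algebroid is smooth if its pairings with all smooth sections are. -/
theorem CourantAlgebroid.contMDiff_of_pairing {a : ∀ x, E x}
    (h : ∀ b : Sec n V E, ContMDiff (𝓡 n) 𝓘(ℝ, ℝ) ∞ (fun x => A.pairing x (a x) (b x))) :
    ContMDiff (𝓡 n) ((𝓡 n).prod 𝓘(ℝ, V)) ∞ (fun x => TotalSpace.mk' V x (a x)) := by
  have := FiniteDimensional.complete ℝ V
  refine contMDiff_of_hom_apply (V₂ := V →L[ℝ] ℝ) (E₂ := fun x => E x →L[ℝ] (Bundle.Trivial M ℝ x))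
    (φ := A.pairing) A.contMDiff_pairing ?_ A.isInvertible_pairing
  exact contMDiff_hom_of_apply (E₂ := Bundle.Trivial M ℝ) fun b => contMDiff_scalar_iff.2 (h b)

theorem CourantAlgebroid.IsExact.anchor_coanchor (hA : A.IsExact) {x : M} (α : Tan n x →L[ℝ] ℝ) :
    A.anchor x (A.coanchor x α) = 0 := (hA.exact x _).2 ⟨α, rfl⟩

/-- Elements of `E` with equal anchor and equal pairings with a complement of the kernel of the
anchor are equal. -/
theorem CourantAlgebroid.IsExact.eq_of_pairing_eq (hA : A.IsExact) {x : M}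
    {σ : Tan n x → E x} (hσ : ∀ u, A.anchor x (σ u) = u) {a b : E x}
    (h : A.anchor x a = A.anchor x b) (h' : ∀ u, A.pairing x a (σ u) = A.pairing x b (σ u)) :
    a = b := by
  have h₀ : A.anchor x (a - b) = 0 := by rw [map_sub, h, sub_self]
  obtain ⟨α, hα⟩ := (hA.exact x _).1 h₀
  have hα₀ : α = 0 := by
    ext u
    have := A.pairing_coanchor x α (σ u)
    rw [hα, hσ, map_sub, sub_apply, h', sub_self] at this
    exact this.symm
  rw [hα₀, map_zero] at hα
  exact sub_eq_zero.1 hα.symm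

/-! ### The lift of tangent vectors to a transverse generalized metric -/

variable {D W : ∀ x : M, Submodule ℝ (E x)}

/-- A kernel vector of ρ is ρ^*α, hence null. A null vector of W lies in D by positivity, and there
ρ is injective. -/
theorem IsTransverseGenMetric.injOn_anchor (hW : IsTransverseGenMetric A D W) (hA : A.IsExact)
    (hproj : IsProjectable A D) (x : M) : InjOn (A.anchor x) (W x : Set (E x)) := by
  have key : ∀ w ∈ W x, A.anchor x w = 0 → w = 0 := by
    intro w hw h
    obtain ⟨α, rfl⟩ := (hA.exact x w).1 h
    have h₀ : A.pairing x (A.coanchor x α) (A.coanchor x α) = 0 := by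
      rw [A.pairing_coanchor, h, map_zero]
    have hD : A.coanchor x α ∈ D x := by
      by_contra hD
      exact (hW.pos x _ hw hD).ne' h₀
    exact hproj x hD (zero_mem _) (by rw [h, map_zero])
  intro a ha b hb hab
  refine sub_eq_zero.1 (key _ (sub_mem ha hb) ?_)
  rw [map_sub, hab, sub_self]

theorem IsTransverseGenMetric.exists_mem_anchor_eq (hW : IsTransverseGenMetric A D W)
    (hA : A.IsExact) (hproj : IsProjectable A D) (x : M) (u : Tan n x) :
    ∃ w ∈ W x, A.anchor x w = u := by
  have := finiteDimensional_fibre V (E := E) x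
  have hinj : Function.Injective ((A.anchor x).toLinearMap.domRestrict (W x)) := fun a b hab =>
    Subtype.ext (hW.injOn_anchor hA hproj x a.2 b.2 hab)
  have hsurj := (LinearMap.injective_iff_surjective_of_finrank_eq_finrank
    ((hW.rank_eq x).trans (finrank_tan x).symm)).1 hinj
  obtain ⟨w, hw⟩ := hsurj u
  exact ⟨w, w.2, hw⟩

variable (A W) in
/-- A smooth right inverse of the anchor with values in `W`. -/
structure AnchorLift where
  toFun : ∀ x, Tan n x →L[ℝ] E x
  contMDiff_toFun : ContMDiff (𝓡 n) ((𝓡 n).prod 𝓘(ℝ, EuclideanSpace ℝ (Fin n) →L[ℝ] V)) ∞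
    (fun x => TotalSpace.mk' (EuclideanSpace ℝ (Fin n) →L[ℝ] V) (E := fun x => Tan n x →L[ℝ] E x)
      x (toFun x))
  mem : ∀ x u, toFun x u ∈ W x
  anchor_apply : ∀ x u, A.anchor x (toFun x u) = u

/-- At each point σ is the inverse of ρ on W. It is smooth because ρ is an isomorphism on the
subbundle W and ρ σ X = X is smooth. -/
theorem IsTransverseGenMetric.nonempty_anchorLift (hW : IsTransverseGenMetric A D W)
    (hA : A.IsExact) (hproj : IsProjectable A D) : Nonempty (AnchorLift A W) := by
  have hex : ∀ x, ∃ σ : Tan n x →L[ℝ] E x, (∀ u, σ u ∈ W x) ∧ ∀ u, A.anchor x (σ u) = u := by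
    intro x
    have hsurj : Function.Surjective ((A.anchor x).toLinearMap.domRestrict (W x)) := fun u => by
      obtain ⟨w, hw, h⟩ := hW.exists_mem_anchor_eq hA hproj x u
      exact ⟨⟨w, hw⟩, h⟩
    obtain ⟨R, hR⟩ := LinearMap.exists_rightInverse_of_surjective _ (LinearMap.range_eq_top.2 hsurj)
    refine ⟨LinearMap.toContinuousLinearMap ((W x).subtype ∘ₗ R), fun u => (R u).2, fun u => ?_⟩
    exact congrArg (fun L : _ →ₗ[ℝ] _ => L u) hR
  choose σ hσW hσ using hex
  refine ⟨⟨σ, contMDiff_hom_of_apply fun X => ?_, hσW, hσ⟩⟩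
  refine hW.isSubbundle.contMDiff_of_hom_apply A.contMDiff_anchor ?_ (fun x => hσW x (X x))
    (fun x => hW.injOn_anchor hA hproj x) (fun x => hW.exists_mem_anchor_eq hA hproj x)
  exact X.contMDiff.congr fun x => congrArg (TotalSpace.mk' (EuclideanSpace ℝ (Fin n)) x)
    (hσ x (X x))

namespace AnchorLift

variable (σ : AnchorLift A W)

/-- The section `σ X` for a vector field `X`. -/
def sec (X : SmoothVF n M) : Sec n V E :=
  ⟨fun x => σ.toFun x (X x), σ.contMDiff_toFun.clm_bundle_apply X.contMDiff⟩

/-- The bilinear form `⟨σ u, σ v⟩`. -/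
def inner (x : M) : Tan n x →L[ℝ] Tan n x →L[ℝ] ℝ :=
  (ContinuousLinearMap.precomp ℝ (σ.toFun x)) ∘L (A.pairing x) ∘L (σ.toFun x)

theorem inner_apply (x : M) (u v : Tan n x) :
    σ.inner x u v = A.pairing x (σ.toFun x u) (σ.toFun x v) := rfl

theorem inner_symm (x : M) (u v : Tan n x) : σ.inner x u v = σ.inner x v u :=
  A.pairing_symm x _ _

theorem contMDiff_inner_apply (X Y : SmoothVF n M) :
    ContMDiff (𝓡 n) 𝓘(ℝ, ℝ) ∞ (fun x => σ.inner x (X x) (Y x)) :=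
  A.contMDiff_pairing_apply (σ.sec X) (σ.sec Y)

/-- The splitting `u ↦ σ u - ½ ρ^* ⟨σ u, σ ·⟩`. -/
def splitting (hA : A.IsExact) : Splitting A where
  toFun x := σ.toFun x -
    (2⁻¹ : ℝ) • LinearMap.toContinuousLinearMap ((A.coanchor x) ∘ₗ (σ.inner x).toLinearMap)
  contMDiff_toFun := by
    -- Testing against sections b removes ρ^*: its term becomes the smooth function ½⟨σ X, σ ρ b⟩.
    refine contMDiff_hom_of_apply fun X => A.contMDiff_of_pairing fun b => ?_
    have h₁ := A.contMDiff_pairing_apply (σ.sec X) b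
    have h₂ := (contMDiff_const (I' := 𝓘(ℝ, ℝ)) (c := (2⁻¹ : ℝ))).smul
      (σ.contMDiff_inner_apply X (A.anchorSec b))
    refine (h₁.sub h₂).congr fun x => ?_
    change A.pairing x (σ.toFun x (X x) - (2⁻¹ : ℝ) • A.coanchor x (σ.inner x (X x))) (b x) = _
    rw [map_sub, map_smul, sub_apply, smul_apply, A.pairing_coanchor]
    rfl
  anchor_apply x u := by
    change A.anchor x (σ.toFun x u - (2⁻¹ : ℝ) • A.coanchor x (σ.inner x u)) = u
    rw [map_sub, map_smul, hA.anchor_coanchor, smul_zero, sub_zero, σ.anchor_apply]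
  isotropic x u v := by
    -- Each of the two cross terms contributes −½⟨σ u, σ v⟩, and ρ^* has isotropic image; this fixes
    -- the factor ½.
    change A.pairing x (σ.toFun x u - (2⁻¹ : ℝ) • A.coanchor x (σ.inner x u))
      (σ.toFun x v - (2⁻¹ : ℝ) • A.coanchor x (σ.inner x v)) = 0
    simp only [map_sub, map_smul, sub_apply, smul_apply, A.pairing_coanchor,
      hA.anchor_coanchor, σ.anchor_apply, map_zero]
    rw [A.pairing_symm x (σ.toFun x u) (A.coanchor x _), A.pairing_coanchor, σ.anchor_apply,
      σ.inner_symm x v u, σ.inner_apply, smul_eq_mul]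
    ring

theorem splitting_apply (hA : A.IsExact) (x : M) (u : Tan n x) :
    (σ.splitting hA).toFun x u = σ.toFun x u - (2⁻¹ : ℝ) • A.coanchor x (σ.inner x u) := rfl

theorem pairing_splitting (hA : A.IsExact) (x : M) (u v : Tan n x) :
    A.pairing x ((σ.splitting hA).toFun x u) (σ.toFun x v) = 2⁻¹ * σ.inner x u v := by
  rw [splitting_apply, map_sub, map_smul, sub_apply, smul_apply, A.pairing_coanchor,
    σ.anchor_apply, σ.inner_apply, smul_eq_mul]
  ring

end AnchorLift

end Courant

/-! ### W as a graph, uniqueness of the splitting, and brackets with vector fields in ρ(D). -/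

namespace Courant

variable {n : ℕ} {M : Type*} [TopologicalSpace M] [ChartedSpace (EuclideanSpace ℝ (Fin n)) M]
  [IsManifold (𝓡 n) ∞ M] [T2Space M] [SigmaCompactSpace M]

/-- The Lie bracket of smooth vector fields. -/
def vfBracket (X Y : SmoothVF n M) : SmoothVF n M :=
  ⟨VectorField.mlieBracket (𝓡 n) X Y, by
    have : IsManifold (𝓡 n) (((⊤ : ℕ∞) : WithTop ℕ∞) + 1) M := ‹IsManifold (𝓡 n) ∞ M›
    have : IsManifold (𝓡 n) (minSmoothness ℝ 2) M := by
      rw [minSmoothness_of_isRCLikeNormedField]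
      exact IsManifold.of_le (n := ∞) ENat.LEInfty.out
    exact ContDiff.mlieBracket_vectorField (m := ⊤) (n := ⊤) X.contMDiff Y.contMDiff (by simp)⟩

theorem vfBracket_apply (X Y : SmoothVF n M) (x : M) :
    vfBracket X Y x = VectorField.mlieBracket (𝓡 n) X Y x := rfl

variable {V : Type*} [NormedAddCommGroup V] [NormedSpace ℝ V] [FiniteDimensional ℝ V]
  {E : M → Type*} [∀ x, AddCommGroup (E x)] [∀ x, Module ℝ (E x)]
  [TopologicalSpace (TotalSpace V E)] [∀ x, TopologicalSpace (E x)]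
  [∀ x, IsTopologicalAddGroup (E x)] [∀ x, ContinuousSMul ℝ (E x)]
  [FiberBundle V E] [VectorBundle ℝ V E] [ContMDiffVectorBundle ∞ V E (𝓡 n)]
  {A : CourantAlgebroid n V E} {D W : ∀ x : M, Submodule ℝ (E x)}

theorem CourantAlgebroid.anchor_bracket_of_anchor_eq {a b : Sec n V E} {X Y : SmoothVF n M}
    (ha : ∀ x, A.anchor x (a x) = X x) (hb : ∀ x, A.anchor x (b x) = Y x) (x : M) :
    A.anchor x (A.bracket a b x) = vfBracket X Y x := by
  rw [A.anchor_bracket, vfBracket_apply]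
  exact congrArg₂ (fun X Y => VectorField.mlieBracket (𝓡 n) X Y x) (funext ha) (funext hb)

theorem CourantAlgebroid.invariance_of_anchor_eq {a : Sec n V E} {X : SmoothVF n M}
    (ha : ∀ x, A.anchor x (a x) = X x) (b c : Sec n V E) (x : M) :
    mvfderiv (𝓡 n) (fun y => A.pairing y (b y) (c y)) x (X x) =
      A.pairing x (A.bracket a b x) (c x) + A.pairing x (b x) (A.bracket a c x) := by
  rw [← ha, A.invariance]

namespace AnchorLift

variable (σ : AnchorLift A W)

/-- σ ∘ ρ is the identity on W, in particular on D. -/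
theorem mem_iff (hW : IsTransverseGenMetric A D W) (hA : A.IsExact) (hproj : IsProjectable A D)
    {x : M} {u : Tan n x} : σ.toFun x u ∈ D x ↔ u ∈ anchorImage A D x := by
  constructor
  · intro h
    exact ⟨_, h, σ.anchor_apply x u⟩
  · rintro ⟨d, hd, rfl⟩
    have : σ.toFun x (A.anchor x d) = d := hW.injOn_anchor hA hproj x (σ.mem x _)
      (hW.le x hd) (σ.anchor_apply x _)
    exact this.symm ▸ hd

/-- This is W ⊂ D^⊥. With `inner_self_pos` it makes the form positive semidefinite with kernel
exactly ρ(D), as a metric pulled back from the leaf space must be. -/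
theorem inner_eq_zero_of_mem (hW : IsTransverseGenMetric A D W) (hA : A.IsExact)
    (hproj : IsProjectable A D) {x : M} {u : Tan n x} (hu : u ∈ anchorImage A D x) (v : Tan n x) :
    σ.inner x u v = 0 := by
  rw [σ.inner_symm]
  exact hW.orthogonal x _ (σ.mem x v) _ ((σ.mem_iff hW hA hproj).2 hu)

theorem inner_self_pos (hW : IsTransverseGenMetric A D W) (hA : A.IsExact)
    (hproj : IsProjectable A D) {x : M} {u : Tan n x} (hu : u ∉ anchorImage A D x) :
    0 < σ.inner x u u :=
  hW.pos x _ (σ.mem x u) fun h => hu ((σ.mem_iff hW hA hproj).1 h)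

/-- The correction term ½ρ^*⟨σ u, σ ·⟩ vanishes on the kernel of the form. -/
theorem splitting_eq_of_mem (hW : IsTransverseGenMetric A D W) (hA : A.IsExact)
    (hproj : IsProjectable A D) {x : M} {u : Tan n x} (hu : u ∈ anchorImage A D x) :
    (σ.splitting hA).toFun x u = σ.toFun x u := by
  have : σ.inner x u = 0 := by
    ext v
    exact σ.inner_eq_zero_of_mem hW hA hproj hu v
  rw [splitting_apply, this, map_zero, smul_zero, sub_zero]

theorem toE_splitting_half_inner (hA : A.IsExact) (x : M) (u : Tan n x) :
    (σ.splitting hA).toE x (u, (2⁻¹ : ℝ) • σ.inner x u) = σ.toFun x u := by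
  rw [Splitting.toE_apply, splitting_apply, map_smul, sub_add_cancel]

/-- `W` is the graph of `½ ⟨σ ·, σ ·⟩` for the splitting defined by `σ`. -/
theorem eq_graph (hW : IsTransverseGenMetric A D W) (hA : A.IsExact) (hproj : IsProjectable A D)
    {g : ∀ x : M, Tan n x →L[ℝ] Tan n x →L[ℝ] ℝ} (hg : ∀ x u v, g x u v = 2⁻¹ * σ.inner x u v) :
    W = (σ.splitting hA).graph g := by
  have hg' : ∀ x u, g x u = (2⁻¹ : ℝ) • σ.inner x u := fun x u => by
    ext v
    exact hg x u v
  funext x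
  ext w
  constructor
  · intro hw
    refine ⟨(A.anchor x w, g x (A.anchor x w)), rfl, ?_⟩
    rw [hg', toE_splitting_half_inner]
    exact hW.injOn_anchor hA hproj x (σ.mem x _) hw (σ.anchor_apply x _)
  · rintro ⟨⟨u, α⟩, hα, rfl⟩
    have hα : α = g x u := hα
    rw [hα, hg', toE_splitting_half_inner]
    exact σ.mem x u

/-- A splitting for which `W` is the graph of a symmetric form is the one defined by `σ`. -/
theorem eq_splitting_of_eq_graph (hA : A.IsExact) {s : Splitting A}
    {g : ∀ x : M, Tan n x →L[ℝ] Tan n x →L[ℝ] ℝ} (hsymm : ∀ x u v, g x u v = g x v u)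
    (hg : W = s.graph g) : s = σ.splitting hA := by
  -- σ u lies in the graph, over some v; applying the anchor gives v = u.
  have h₁ : ∀ x u, s.toE x (u, g x u) = σ.toFun x u := by
    intro x u
    have hu := σ.mem x u
    rw [congrFun hg x] at hu
    obtain ⟨⟨v, α⟩, hα, hv⟩ := hu
    have hα : α = g x v := hα
    have huv := congrArg (A.anchor x) hv
    rw [Splitting.toE_apply, map_add, s.anchor_apply, hA.anchor_coanchor, add_zero,
      σ.anchor_apply] at huv
    rw [← huv, ← hα, hv, huv]
  -- Two elements of the graph pair to g(u, v) + g(v, u), which by symmetry is 2 g(u, v).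
  have h₂ : ∀ x u, g x u = (2⁻¹ : ℝ) • σ.inner x u := by
    intro x u
    ext v
    change g x u v = 2⁻¹ * σ.inner x u v
    rw [σ.inner_apply, ← h₁, ← h₁, s.pairing_toE hA, hsymm x v u]
    ring
  ext x u
  rw [splitting_apply, ← h₁, s.toE_apply, h₂, map_smul, add_sub_cancel_right]

variable {U : SmoothVF n M}

/-- Both sides lie in W, the left by [Γ(D), Γ(W)] ⊂ Γ(W), and have the same anchor. -/
theorem bracket_sec (hW : IsTransverseGenMetric A D W) (hA : A.IsExact)
    (hproj : IsProjectable A D) (hU : ∀ x, U x ∈ anchorImage A D x) (X : SmoothVF n M) (x : M) :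
    A.bracket (σ.sec U) (σ.sec X) x = σ.sec (vfBracket U X) x := by
  refine hW.injOn_anchor hA hproj x (hW.invariant _ _
    (fun y => (σ.mem_iff hW hA hproj).2 (hU y)) (fun y => σ.mem y (X y)) x) (σ.mem x _) ?_
  rw [A.anchor_bracket_of_anchor_eq (fun y => σ.anchor_apply y (U y))
    (fun y => σ.anchor_apply y (X y))]
  exact (σ.anchor_apply x _).symm

/-- The Lie derivative of ⟨σ·, σ·⟩ along U vanishes, since [σU, ·] preserves the pairing and
commutes with σ. -/
theorem mvfderiv_inner (hW : IsTransverseGenMetric A D W) (hA : A.IsExact)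
    (hproj : IsProjectable A D) (hU : ∀ x, U x ∈ anchorImage A D x) (X Y : SmoothVF n M) (x : M) :
    mvfderiv (𝓡 n) (fun y => σ.inner y (X y) (Y y)) x (U x) =
      σ.inner x (vfBracket U X x) (Y x) + σ.inner x (X x) (vfBracket U Y x) := by
  have := A.invariance_of_anchor_eq (a := σ.sec U) (fun y => σ.anchor_apply y (U y))
    (σ.sec X) (σ.sec Y) x
  rw [σ.bracket_sec hW hA hproj hU, σ.bracket_sec hW hA hproj hU] at this
  exact this

/-- The splitting is built from σ and ⟨σ·, σ·⟩, both invariant under U, so it is invariant too. The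
two sides have equal anchors, so it is enough to compare their pairings with the vectors σ Z. -/
theorem bracket_splitting_sec (hW : IsTransverseGenMetric A D W) (hA : A.IsExact)
    (hproj : IsProjectable A D) (hU : ∀ x, U x ∈ anchorImage A D x) (X : SmoothVF n M) :
    A.bracket ((σ.splitting hA).sec U) ((σ.splitting hA).sec X) =
      (σ.splitting hA).sec (vfBracket U X) := by
  have hsec : (σ.splitting hA).sec U = σ.sec U := by
    ext x
    exact σ.splitting_eq_of_mem hW hA hproj (hU x)
  rw [hsec]
  ext x
  refine hA.eq_of_pairing_eq (σ.anchor_apply x) ?_ fun z => ?_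
  · rw [A.anchor_bracket_of_anchor_eq (fun y => σ.anchor_apply y (U y))
      (fun y => (σ.splitting hA).anchor_apply y (X y))]
    exact ((σ.splitting hA).anchor_apply x _).symm
  · obtain ⟨Z, rfl⟩ := exists_section_apply_eq (n := n) (V₁ := EuclideanSpace ℝ (Fin n)) z
    have h₁ := A.invariance_of_anchor_eq (a := σ.sec U) (fun y => σ.anchor_apply y (U y))
      ((σ.splitting hA).sec X) (σ.sec Z) x
    rw [σ.bracket_sec hW hA hproj hU] at h₁
    have h₂ : (fun y => A.pairing y ((σ.splitting hA).sec X y) (σ.sec Z y)) =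
        fun y => (2⁻¹ : ℝ) * σ.inner y (X y) (Z y) :=
      funext fun y => σ.pairing_splitting hA y (X y) (Z y)
    have h₃ : A.pairing x ((σ.splitting hA).sec X x) (σ.sec (vfBracket U Z) x) =
        2⁻¹ * σ.inner x (X x) (vfBracket U Z x) := σ.pairing_splitting hA x _ _
    have h₄ : A.pairing x ((σ.splitting hA).sec (vfBracket U X) x) (σ.toFun x (Z x)) =
        2⁻¹ * σ.inner x (vfBracket U X x) (Z x) := σ.pairing_splitting hA x _ _
    have h₅ : mvfderiv (𝓡 n) (fun y => (2⁻¹ : ℝ) * σ.inner y (X y) (Z y)) x (U x) =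
        2⁻¹ * mvfderiv (𝓡 n) (fun y => σ.inner y (X y) (Z y)) x (U x) := by
      have := mvfderiv_fun_mul (I := 𝓡 n) (f := fun _ : M => (2⁻¹ : ℝ)) (x := x)
        mdifferentiableAt_const ((σ.contMDiff_inner_apply X Z).mdifferentiableAt (by simp))
      rw [mvfderiv_const, smul_zero, add_zero] at this
      exact congrArg (fun L => L (U x)) this
    -- Both ½ U⟨σX, σZ⟩ = ⟨[σU, sX], σZ⟩ + ½⟨σX, σ[U, Z]⟩ and `mvfderiv_inner` hold; the terms with
    -- [U, Z] cancel.
    rw [h₂, h₅, h₃, σ.mvfderiv_inner hW hA hproj hU] at h₁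
    rw [h₄]
    change A.pairing x (A.bracket (σ.sec U) ((σ.splitting hA).sec X) x) (σ.sec Z x) = _
    linarith

end AnchorLift

end Courant

/-! ### Alternating maps on vector fields and the closed 3-form of a splitting. -/

theorem MultilinearMap.continuous_of_euclideanSpace {n : ℕ} {ι : Type*} [Fintype ι]
    (f : MultilinearMap ℝ (fun _ : ι => EuclideanSpace ℝ (Fin n)) ℝ) : Continuous f := by
  classical
  let b := EuclideanSpace.basisFun (Fin n) ℝ
  -- Expanded in the standard basis, f is a polynomial in the coordinates.
  have h : ∀ v, f v = ∑ r : ι → Fin n, (∏ i, v i (r i)) • f (fun i => b (r i)) := by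
    intro v
    have hv : v = fun i => ∑ j, v i j • b j := funext fun i => (b.sum_repr (v i)).symm
    conv_lhs => rw [hv, f.map_sum]
    exact Finset.sum_congr rfl fun r _ => f.map_smul_univ _ _
  rw [show (f : _ → ℝ) = fun v => _ from funext h]
  fun_prop

/-- A multilinear map vanishing whenever some argument is in a submodule `K` depends only on the
arguments modulo `K`. -/
theorem MultilinearMap.apply_eq_of_sub_mem {R ι N P : Type*} [Ring R] [AddCommGroup N] [Module R N]
    [AddCommGroup P] [Module R P] [Fintype ι] (f : MultilinearMap R (fun _ : ι => N) P)
    {K : Submodule R N} (hf : ∀ v i, v i ∈ K → f v = 0) {u v : ι → N} (h : ∀ i, u i - v i ∈ K) :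
    f u = f v := by
  classical
  -- Induction on the set s of slots where w may differ from v, changing one slot at a time.
  have key : ∀ (s : Finset ι) (w : ι → N), (∀ i ∉ s, w i = v i) → (∀ i, w i - v i ∈ K) →
      f w = f v := by
    intro s
    induction s using Finset.induction_on with
    | empty => exact fun w h _ => congrArg f (funext fun i => h i (Finset.notMem_empty i))
    | insert j s hj ih =>
      intro w hw hwK
      rw [← ih (Function.update w j (v j)) ?_ ?_]
      · have h := hf (Function.update w j (w j - v j)) j
          (by rw [Function.update_self]; exact hwK j)
        rw [f.map_update_sub, Function.update_eq_self] at h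
        exact sub_eq_zero.1 h
      · intro i hi
        by_cases hij : i = j
        · rw [hij, Function.update_self]
        · rw [Function.update_of_ne hij]
          exact hw i (by simp [hij, hi])
      · intro i
        by_cases hij : i = j
        · rw [hij, Function.update_self, sub_self]
          exact K.zero_mem
        · rw [Function.update_of_ne hij]
          exact hwK i
  exact key Finset.univ u (fun i hi => absurd (Finset.mem_univ i) hi) h

namespace Courant

variable {n : ℕ} {M : Type*} [TopologicalSpace M] [ChartedSpace (EuclideanSpace ℝ (Fin n)) M]
  [IsManifold (𝓡 n) ∞ M] [T2Space M] [SigmaCompactSpace M]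

/-- The value of vector fields at `x`. -/
def evalVF (x : M) : SmoothVF n M →ₗ[ℝ] Tan n x where
  toFun X := X x
  map_add' _ _ := rfl
  map_smul' _ _ := rfl

theorem exists_rightInverse_evalVF (x : M) :
    ∃ L : Tan n x →ₗ[ℝ] SmoothVF n M, evalVF x ∘ₗ L = LinearMap.id :=
  LinearMap.exists_rightInverse_of_surjective _
    (LinearMap.range_eq_top.2 fun v => exists_section_apply_eq v)

/-- An alternating map on vector fields, as a form on the tangent space at `x`. -/
def formOfAlternating {k : ℕ} (x : M) (T : SmoothVF n M [⋀^Fin k]→ₗ[ℝ] ℝ) :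
    Tan n x [⋀^Fin k]→L[ℝ] ℝ :=
  { T.compLinearMap (exists_rightInverse_evalVF x).choose with
    cont := MultilinearMap.continuous_of_euclideanSpace
      (T.compLinearMap (exists_rightInverse_evalVF x).choose).toMultilinearMap }

/-- `formOfAlternating` extends tangent vectors to fields by an arbitrary linear choice. When T is
tensorial the choice is immaterial, as two extensions differ by a field vanishing at x. -/
theorem formOfAlternating_apply {k : ℕ} (x : M) (T : SmoothVF n M [⋀^Fin k]→ₗ[ℝ] ℝ)
    (hT : ∀ (X : Fin k → SmoothVF n M) (i : Fin k), X i x = 0 → T X = 0)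
    (X : Fin k → SmoothVF n M) : formOfAlternating x T (fun i => X i x) = T X := by
  have hL : ∀ v : Tan n x, evalVF x ((exists_rightInverse_evalVF x).choose v) = v := fun v =>
    congrArg (fun f : _ →ₗ[ℝ] _ => f v) (exists_rightInverse_evalVF x).choose_spec
  refine T.toMultilinearMap.apply_eq_of_sub_mem (K := LinearMap.ker (evalVF x)) hT fun i => ?_
  rw [LinearMap.mem_ker, map_sub, hL]
  exact sub_self (X i x)

variable {V : Type*} [NormedAddCommGroup V] [NormedSpace ℝ V] [FiniteDimensional ℝ V]
  {E : M → Type*} [∀ x, AddCommGroup (E x)] [∀ x, Module ℝ (E x)]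
  [TopologicalSpace (TotalSpace V E)] [∀ x, TopologicalSpace (E x)]
  [∀ x, IsTopologicalAddGroup (E x)] [∀ x, ContinuousSMul ℝ (E x)]
  [FiberBundle V E] [VectorBundle ℝ V E] [ContMDiffVectorBundle ∞ V E (𝓡 n)]
  {A : CourantAlgebroid n V E}

namespace Splitting

variable (s : Splitting A)

theorem sec_add (X Y : SmoothVF n M) : s.sec (X + Y) = s.sec X + s.sec Y := by
  ext x
  exact (s.toFun x).map_add _ _

theorem sec_smul (c : ℝ) (X : SmoothVF n M) : s.sec (c • X) = c • s.sec X := by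
  ext x
  exact (s.toFun x).map_smul _ _

/-- `⟨[s X, s Y], s Z⟩` -/
def torsion (X Y Z : SmoothVF n M) (x : M) : ℝ :=
  A.pairing x (A.bracket (s.sec X) (s.sec Y) x) (s.sec Z x)

/-- The symmetric part of the bracket is ρ^*d⟨sX, sY⟩, which is zero by isotropy. -/
theorem torsion_swap_left (X Y Z : SmoothVF n M) (x : M) :
    s.torsion Y X Z x = - s.torsion X Y Z x := by
  have h := A.bracket_symm (s.sec X) (s.sec Y) (s.sec Z) x
  have h₀ : (fun y => A.pairing y (s.sec X y) (s.sec Y y)) = fun _ => 0 :=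
    funext fun y => s.isotropic y _ _
  rw [h₀, mvfderiv_const, map_add, add_apply] at h
  have h : s.torsion X Y Z x + s.torsion Y X Z x = 0 := h
  linarith

/-- Invariance of the pairing, applied to the zero function ⟨sY, sZ⟩. -/
theorem torsion_swap_right (X Y Z : SmoothVF n M) (x : M) :
    s.torsion X Z Y x = - s.torsion X Y Z x := by
  have h := A.invariance (s.sec X) (s.sec Y) (s.sec Z) x
  have h₀ : (fun y => A.pairing y (s.sec Y y) (s.sec Z y)) = fun _ => 0 :=
    funext fun y => s.isotropic y _ _
  rw [h₀, mvfderiv_const, A.pairing_symm x (s.sec Y x)] at h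
  have h : 0 = s.torsion X Y Z x + s.torsion X Z Y x := h
  linarith

theorem torsion_rotate (X Y Z : SmoothVF n M) (x : M) : s.torsion Y Z X x = s.torsion X Y Z x := by
  rw [s.torsion_swap_right Y X Z, s.torsion_swap_left X Y Z, neg_neg]

theorem torsion_add_left (X X' Y Z : SmoothVF n M) (x : M) :
    s.torsion (X + X') Y Z x = s.torsion X Y Z x + s.torsion X' Y Z x := by
  unfold torsion
  rw [sec_add, map_add, LinearMap.add_apply, ContMDiffSection.coe_add, Pi.add_apply, map_add,
    add_apply]

theorem torsion_smul_left (c : ℝ) (X Y Z : SmoothVF n M) (x : M) :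
    s.torsion (c • X) Y Z x = c • s.torsion X Y Z x := by
  unfold torsion
  rw [sec_smul, map_smul, LinearMap.smul_apply, ContMDiffSection.coe_smul, Pi.smul_apply, map_smul,
    smul_apply]

/-- Tensoriality is evident in the last slot, where no bracket occurs; cyclic symmetry carries it to
the others without the Leibniz rule. -/
theorem torsion_eq_zero_of_right {Z : SmoothVF n M} {x : M} (h : Z x = 0) (X Y : SmoothVF n M) :
    s.torsion X Y Z x = 0 := by
  have : s.sec Z x = 0 := (congrArg (s.toFun x) h).trans (map_zero _)
  rw [torsion, this, map_zero]

/-- The `3`-form of the splitting at `x`, as an alternating map on vector fields. -/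
def torsionAlternating (x : M) : SmoothVF n M [⋀^Fin 3]→ₗ[ℝ] ℝ where
  toFun X := s.torsion (X 0) (X 1) (X 2) x
  map_update_add' := by
    intro inst X i Y Z
    -- The axiom is quantified over all decidability instances; with the canonical one the updates
    -- compute. Linearity is known in the first slot, and rotation brings the other slots there.
    obtain rfl : inst = instDecidableEqFin 3 := Subsingleton.elim _ _
    fin_cases i
    · simpa using! s.torsion_add_left Y Z (X 1) (X 2) x
    · simpa [← s.torsion_rotate (X 0)] using! s.torsion_add_left Y Z (X 2) (X 0) x
    · simpa [s.torsion_rotate _ (X 0) (X 1)] using! s.torsion_add_left Y Z (X 0) (X 1) x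
  map_update_smul' := by
    intro inst X i c Y
    obtain rfl : inst = instDecidableEqFin 3 := Subsingleton.elim _ _
    fin_cases i
    · simpa using! s.torsion_smul_left c Y (X 1) (X 2) x
    · simpa [← s.torsion_rotate (X 0)] using! s.torsion_smul_left c Y (X 2) (X 0) x
    · simpa [s.torsion_rotate _ (X 0) (X 1)] using! s.torsion_smul_left c Y (X 0) (X 1) x
  map_eq_zero_of_eq' X i j h hij := by
    have h₀₁ : ∀ X Z, s.torsion X X Z x = 0 := fun X Z => by
      linarith [s.torsion_swap_left X X Z x]
    have h₁₂ : ∀ X Z, s.torsion Z X X x = 0 := fun X Z => by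
      rw [← s.torsion_rotate, h₀₁]
    have h₀₂ : ∀ X Z, s.torsion X Z X x = 0 := fun X Z => by
      rw [s.torsion_swap_left, h₁₂, neg_zero]
    fin_cases i <;> fin_cases j <;> simp at h hij ⊢ <;> simp [h, h₀₁, h₁₂, h₀₂]

/-- The `3`-form of a splitting. -/
def threeForm : Form n M 3 := fun x => formOfAlternating x (s.torsionAlternating x)

theorem threeForm_apply (X : Fin 3 → SmoothVF n M) (x : M) :
    s.threeForm x (fun i => X i x) = s.torsion (X 0) (X 1) (X 2) x := by
  refine formOfAlternating_apply x _ (fun X i hi => ?_) X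
  change s.torsion (X 0) (X 1) (X 2) x = 0
  fin_cases i
  · rw [← s.torsion_rotate]
    exact s.torsion_eq_zero_of_right hi _ _
  · rw [← s.torsion_rotate, ← s.torsion_rotate]
    exact s.torsion_eq_zero_of_right hi _ _
  · exact s.torsion_eq_zero_of_right hi _ _

theorem contMDiff_torsion (X Y Z : SmoothVF n M) :
    ContMDiff (𝓡 n) 𝓘(ℝ, ℝ) ∞ (s.torsion X Y Z) :=
  A.contMDiff_pairing_apply _ _

/-- Under E ≅ TM ⊕ T^*M the pairing is α(v) + β(u), and each summand is the pairing of one element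
with the tangent part of the other. -/
theorem pairing_eq (hA : A.IsExact) {x : M} (a b : E x) :
    A.pairing x a b = A.pairing x a (s.toFun x (A.anchor x b)) +
      A.pairing x b (s.toFun x (A.anchor x a)) := by
  obtain ⟨⟨u, α⟩, rfl⟩ := (s.bijective_toE hA x).2 a
  obtain ⟨⟨v, β⟩, rfl⟩ := (s.bijective_toE hA x).2 b
  have h : ∀ w γ, s.toFun x (A.anchor x (s.toE x (w, γ))) = s.toE x (w, 0) := by
    intro w γ
    rw [s.toE_apply, s.toE_apply, map_add, s.anchor_apply, hA.anchor_coanchor, add_zero, map_zero,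
      add_zero]
  rw [h, h]
  simp [s.pairing_toE hA]

theorem pairing_bracket_bracket (hA : A.IsExact) (X Y Z Z' : SmoothVF n M) (x : M) :
    A.pairing x (A.bracket (s.sec X) (s.sec Y) x) (A.bracket (s.sec Z) (s.sec Z') x) =
      s.torsion X Y (vfBracket Z Z') x + s.torsion Z Z' (vfBracket X Y) x := by
  rw [s.pairing_eq hA, A.anchor_bracket_of_anchor_eq (fun y => s.anchor_apply y (Z y))
      (fun y => s.anchor_apply y (Z' y)), A.anchor_bracket_of_anchor_eq
      (fun y => s.anchor_apply y (X y)) (fun y => s.anchor_apply y (Y y))]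
  rfl

/-- The invariance of the pairing and the Jacobi identity show that the `3`-form is closed. -/
theorem torsion_closed (hA : A.IsExact) (X Y Z Z' : SmoothVF n M) (x : M) :
    mvfderiv (𝓡 n) (s.torsion Y Z Z') x (X x) - mvfderiv (𝓡 n) (s.torsion X Z Z') x (Y x) +
        mvfderiv (𝓡 n) (s.torsion X Y Z') x (Z x) - mvfderiv (𝓡 n) (s.torsion X Y Z) x (Z' x) =
      s.torsion Y Z (vfBracket X Z') x + s.torsion X Z' (vfBracket Y Z) x
      - s.torsion X Z (vfBracket Y Z') x - s.torsion Y Z' (vfBracket X Z) x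
      + s.torsion X Y (vfBracket Z Z') x + s.torsion Z Z' (vfBracket X Y) x := by
  have inv : ∀ (X : SmoothVF n M) (b c : Sec n V E), mvfderiv (𝓡 n) (fun y =>
      A.pairing y (b y) (c y)) x (X x) = A.pairing x (A.bracket (s.sec X) b x) (c x) +
      A.pairing x (b x) (A.bracket (s.sec X) c x) := fun X b c =>
    A.invariance_of_anchor_eq (fun y => s.anchor_apply y (X y)) b c x
  -- Invariance gives the derivatives along X, Y and Z, and the symmetry axiom for [sX, sY] and sZ
  -- gives the one along Z'. In the alternating sum the triple brackets cancel by the Jacobi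
  -- identity, leaving pairings of two brackets.
  have h₁ := inv X (A.bracket (s.sec Y) (s.sec Z)) (s.sec Z')
  have h₂ := inv Y (A.bracket (s.sec X) (s.sec Z)) (s.sec Z')
  have h₃ := inv Z (A.bracket (s.sec X) (s.sec Y)) (s.sec Z')
  have h₄ := A.bracket_symm (A.bracket (s.sec X) (s.sec Y)) (s.sec Z) (s.sec Z') x
  have h₅ := congrArg (fun a : Sec n V E => A.pairing x (a x) (s.sec Z' x))
    (A.jacobi (s.sec X) (s.sec Y) (s.sec Z))
  simp only [ContMDiffSection.coe_add, Pi.add_apply, map_add, add_apply] at h₄ h₅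
  rw [s.pairing_bracket_bracket hA] at h₁ h₂ h₃
  have h₆ : A.anchor x (s.sec Z' x) = Z' x := s.anchor_apply x _
  rw [h₆] at h₄
  change mvfderiv (𝓡 n) (s.torsion Y Z Z') x (X x) = _ at h₁
  change mvfderiv (𝓡 n) (s.torsion X Z Z') x (Y x) = _ at h₂
  change mvfderiv (𝓡 n) (s.torsion X Y Z') x (Z x) = _ at h₃
  change _ = mvfderiv (𝓡 n) (s.torsion X Y Z) x (Z' x) at h₄
  linarith

theorem isClosed_threeForm (hA : A.IsExact) : s.threeForm.IsClosed := by
  intro X x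
  have h₁ : ∀ i : Fin 4, (fun y => s.threeForm y (i.removeNth fun l => X l y)) =
      s.torsion (X (i.succAbove 0)) (X (i.succAbove 1)) (X (i.succAbove 2)) := fun i =>
    funext fun y => s.threeForm_apply (fun j => X (i.succAbove j)) y
  have h₂ : ∀ i j : Fin 3, s.threeForm x (Matrix.vecCons
      (VectorField.mlieBracket (𝓡 n) (X i.castSucc) (X j.succ) x)
        (j.removeNth (i.castSucc.removeNth (fun l => X l x)))) =
      s.torsion (X (i.castSucc.succAbove (j.succAbove 0))) (X (i.castSucc.succAbove (j.succAbove 1)))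
        (vfBracket (X i.castSucc) (X j.succ)) x := by
    intro i j
    -- `extDerivOn` has the bracket in the first slot and `torsion_closed` in the last; cyclic
    -- rotations of three slots cost no sign.
    rw [← s.torsion_rotate, ← s.torsion_rotate]
    refine Eq.trans (congrArg _ (funext fun l => ?_)) (s.threeForm_apply
      ![vfBracket (X i.castSucc) (X j.succ), X (i.castSucc.succAbove (j.succAbove 0)),
        X (i.castSucc.succAbove (j.succAbove 1))] x)
    fin_cases l <;> rfl
  have e₀ : Finset.Ici (0 : Fin 3) = {0, 1, 2} := rfl
  have e₁ : Finset.Ici (1 : Fin 3) = {1, 2} := rfl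
  have e₂ : Finset.Ici (2 : Fin 3) = {2} := rfl
  have key := s.torsion_closed hA (X 0) (X 1) (X 2) (X 3) x
  rw [Form.extDerivOn, Fin.sum_univ_four, Fin.sum_univ_three, e₀, e₁, e₂,
    Finset.sum_insert (by decide), Finset.sum_insert (by decide), Finset.sum_insert (by decide),
    Finset.sum_singleton, Finset.sum_singleton, Finset.sum_singleton]
  rw [h₁ 0, h₁ 1, h₁ 2, h₁ 3, h₂ 0 0, h₂ 0 1, h₂ 0 2, h₂ 1 1, h₂ 1 2, h₂ 2 2]
  have f₀ : ((0 : Fin 3) : ℕ) = 0 := rfl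
  have f₁ : ((1 : Fin 3) : ℕ) = 1 := rfl
  have f₂ : ((2 : Fin 3) : ℕ) = 2 := rfl
  have f₃ : ((0 : Fin 4) : ℕ) = 0 := rfl
  have f₄ : ((1 : Fin 4) : ℕ) = 1 := rfl
  have f₅ : ((2 : Fin 4) : ℕ) = 2 := rfl
  have f₆ : ((3 : Fin 4) : ℕ) = 3 := rfl
  rw [f₀, f₁, f₂, f₃, f₄, f₅, f₆]
  change _ * mvfderiv (𝓡 n) (s.torsion (X 1) (X 2) (X 3)) x (X 0 x) +
    _ * mvfderiv (𝓡 n) (s.torsion (X 0) (X 2) (X 3)) x (X 1 x) +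
    _ * mvfderiv (𝓡 n) (s.torsion (X 0) (X 1) (X 3)) x (X 2 x) +
    _ * mvfderiv (𝓡 n) (s.torsion (X 0) (X 1) (X 2)) x (X 3 x) -
    ((_ * s.torsion (X 2) (X 3) (vfBracket (X 0) (X 1)) x +
      (_ * s.torsion (X 1) (X 3) (vfBracket (X 0) (X 2)) x +
       _ * s.torsion (X 1) (X 2) (vfBracket (X 0) (X 3)) x)) +
     (_ * s.torsion (X 0) (X 3) (vfBracket (X 1) (X 2)) x +
      _ * s.torsion (X 0) (X 2) (vfBracket (X 1) (X 3)) x) +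
     _ * s.torsion (X 0) (X 1) (vfBracket (X 2) (X 3)) x) = 0
  norm_num
  linarith

end Splitting

end Courant

/-! ### Integral manifolds and the fibres of a submersion. -/

namespace Courant.IsConnectedIntegralManifold

variable {n m : ℕ} {M : Type u} [TopologicalSpace M] [ChartedSpace (EuclideanSpace ℝ (Fin n)) M]
  [IsManifold (𝓡 n) ∞ M] [T2Space M] [SigmaCompactSpace M]
  {Δ : ∀ x : M, Submodule ℝ (Tan n x)} {L : Set M}

/-- A function whose differential vanishes along a distribution is constant on the connected
integral manifolds. -/
theorem apply_eq (hL : IsConnectedIntegralManifold Δ L) {f : M → ℝ}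
    (hf : ContMDiff (𝓡 n) 𝓘(ℝ, ℝ) ∞ f) (hΔ : ∀ x, ∀ u ∈ Δ x, mvfderiv (𝓡 n) f x u = 0)
    {x y : M} (hx : x ∈ L) (hy : y ∈ L) : f x = f y := by
  obtain ⟨r, N, _, _, _, _, _, _, i, hi, -, rfl, hd⟩ := hL
  obtain ⟨x, rfl⟩ := hx
  obtain ⟨y, rfl⟩ := hy
  refine eq_of_mfderiv_eq_zero (f := f ∘ i) (hf.comp hi) (fun z => ?_) x y
  rw [mfderiv_comp z (hf.mdifferentiableAt (by simp)) (hi.mdifferentiableAt (by simp))]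
  ext v
  refine hΔ (i z) _ ?_
  rw [← (hd z).2]
  exact ⟨v, rfl⟩

variable {Q : Type*} [TopologicalSpace Q] [ChartedSpace (EuclideanSpace ℝ (Fin m)) Q]
  [IsManifold (𝓡 m) ∞ Q] {p : M → Q}

/-- If a fibre of a submersion is an integral manifold of a distribution, then the distribution is
there the kernel of the differential. -/
theorem eq_ker (hp : IsSubmersion (𝓡 n) (𝓡 m) ∞ p) {x : M}
    (hL : IsConnectedIntegralManifold Δ (p ⁻¹' {p x})) :
    Δ x = (mfderiv (𝓡 n) (𝓡 m) p x).ker := by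
  obtain ⟨r, N, _, _, _, _, _, _, i, hi, -, hrange, hd⟩ := hL
  obtain ⟨y, rfl⟩ : x ∈ range i := hrange ▸ rfl
  have hfib : ∀ z, p (i z) = p (i y) := fun z => by
    have : i z ∈ p ⁻¹' {p (i y)} := hrange ▸ mem_range_self z
    exact this
  have hle : Δ (i y) ≤ (mfderiv (𝓡 n) (𝓡 m) p (i y)).ker := by
    rw [← (hd y).2]
    rintro _ ⟨v, rfl⟩
    have h₁ := mfderiv_comp y (hp.contMDiff.mdifferentiableAt (x := i y) (by simp))
      (hi.mdifferentiableAt (by simp))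
    have h₂ : p ∘ i = fun _ => p (i y) := funext hfib
    rw [h₂, mfderiv_const] at h₁
    exact (congrArg (fun l => l v) h₁).symm
  refine Submodule.eq_of_le_of_finrank_le hle ?_
  -- The immersion might carry a finer topology than the fibre, so dimensions are compared through
  -- images: the fibre fills a neighbourhood in F, of dimension n − m, yet is a smooth image of an
  -- r-manifold. Hence n − m ≤ r.
  obtain ⟨F, _, _, _, c, O, hdim, hO, hyO, hc, himg⟩ :=
    (hp.isSubmersionAt (i y)).exists_fibre_chart
  have h₁ : ContMDiffOn (𝓡 r) 𝓘(ℝ, F) ∞ (c ∘ i) (i ⁻¹' O) :=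
    hc.comp hi.contMDiffOn (fun z hz => hz)
  have h₂ := dimH_image_le_of_contMDiffOn (hO.preimage hi.continuous) h₁
  have h₃ : c '' (O ∩ p ⁻¹' {p (i y)}) ⊆ (c ∘ i) '' (i ⁻¹' O) := by
    rintro _ ⟨z, ⟨hzO, hz⟩, rfl⟩
    obtain ⟨w, rfl⟩ := hrange.symm ▸ hz
    exact ⟨w, hzO, rfl⟩
  have h₄ := (dimH_mono h₃).trans h₂
  rw [Real.dimH_of_mem_nhds himg] at h₄
  have h₅ : Module.finrank ℝ F ≤ r := by exact_mod_cast h₄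
  have h₆ : Module.finrank ℝ (Δ (i y)) = r := by
    rw [← (hd y).2]
    exact (LinearMap.finrank_range_of_inj (hd y).1).trans (finrank_tan y)
  have h₇ := (mfderiv (𝓡 n) (𝓡 m) p (i y)).toLinearMap.finrank_range_add_finrank_ker
  rw [LinearMap.range_eq_top.2 (hp.isSubmersionAt (i y)).mfderiv_surjective, finrank_top,
    finrank_tan, finrank_tan] at h₇
  rw [h₆]
  change Module.finrank ℝ (mfderiv (𝓡 n) (𝓡 m) p (i y)).toLinearMap.ker ≤ r
  omega

end Courant.IsConnectedIntegralManifold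

namespace Courant

/-! ### Descent along a submersion -/

variable {n m : ℕ} {M : Type*} [TopologicalSpace M] [ChartedSpace (EuclideanSpace ℝ (Fin n)) M]
  [IsManifold (𝓡 n) ∞ M] [T2Space M] [SigmaCompactSpace M]
  {Q : Type*} [TopologicalSpace Q] [ChartedSpace (EuclideanSpace ℝ (Fin m)) Q]
  [IsManifold (𝓡 m) ∞ Q] {p : M → Q}

/-- The exterior derivative is natural. -/
theorem extDerivOn_pullback (hp : ContMDiff (𝓡 n) (𝓡 m) ∞ p) {k : ℕ} {η : Form m Q (k + 1)}
    (hη : η.IsSmooth) {X : Fin (k + 2) → SmoothVF n M} {Y : Fin (k + 2) → SmoothVF m Q}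
    (hXY : ∀ i x, mfderiv (𝓡 n) (𝓡 m) p x (X i x) = Y i (p x)) (x : M) :
    Form.extDerivOn (Form.pullback p η) X x = Form.extDerivOn η Y (p x) := by
  unfold Form.extDerivOn
  refine congrArg₂ _ (Finset.sum_congr rfl fun i _ => congrArg _ ?_)
    (Finset.sum_congr rfl fun i _ => Finset.sum_congr rfl fun j _ => congrArg _ ?_)
  · have h₁ : (fun y => Form.pullback p η y (i.removeNth fun l => X l y)) =
        (fun q => η q (i.removeNth fun l => Y l q)) ∘ p :=
      funext fun y => congrArg (η (p y)) (funext fun j => hXY (i.succAbove j) y)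
    have h₂ : ContMDiff (𝓡 m) 𝓘(ℝ, ℝ) ∞ (fun q => η q (i.removeNth fun l => Y l q)) :=
      hη fun j => Y (i.succAbove j)
    rw [h₁, mvfderiv_comp_apply x (h₂.mdifferentiableAt (by simp))
      (hp.mdifferentiableAt (by simp)), hXY]
  · refine congrArg (η (p x)) (funext fun l => ?_)
    refine Fin.cases ?_ (fun l => ?_) l
    · exact mfderiv_mlieBracket_of_related hp (hXY _) (hXY _) x
    · exact hXY _ x

/-- Every fibre of a surjective submersion has a point with a right inverse of the differential. -/
theorem exists_fibre_point (hp : IsSubmersion (𝓡 n) (𝓡 m) ∞ p) (hsurj : Function.Surjective p)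
    (q : Q) : ∃ (x : M) (R : Tan m q →L[ℝ] Tan n x), p x = q ∧
      ∀ X : SmoothVF m Q, mfderiv (𝓡 n) (𝓡 m) p x (R (X q)) = X (p x) := by
  -- Testing R on values of vector fields avoids transporting tangent vectors along p x = q.
  obtain ⟨x, rfl⟩ := hsurj q
  obtain ⟨R, hR⟩ := (mfderiv (𝓡 n) (𝓡 m) p x).toLinearMap.exists_rightInverse_of_surjective
    (LinearMap.range_eq_top.2 (hp.isSubmersionAt x).mfderiv_surjective)
  exact ⟨x, LinearMap.toContinuousLinearMap R, rfl, fun X =>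
    congrArg (fun l : _ →ₗ[ℝ] _ => l (X (p x))) hR⟩

variable [T2Space Q] [SigmaCompactSpace Q]

/-- A form on the total space of a submersion is the pullback of a form on the base if it is smooth, is determined by its values
on the projections of its arguments, and is on lifted vector fields constant along the fibres. -/
theorem exists_form_descent (hp : IsSubmersion (𝓡 n) (𝓡 m) ∞ p) (hsurj : Function.Surjective p)
    {k : ℕ} {η : Form n M k}
    (hη : η.IsSmooth)
    (hhor : ∀ x (u v : Fin k → Tan n x), (∀ i, mfderiv (𝓡 n) (𝓡 m) p x (u i) =
      mfderiv (𝓡 n) (𝓡 m) p x (v i)) → η x u = η x v)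
    (hconst : ∀ (X : Fin k → SmoothVF n M) (Y : Fin k → SmoothVF m Q),
      (∀ i x, mfderiv (𝓡 n) (𝓡 m) p x (X i x) = Y i (p x)) →
      ∀ x y, p x = p y → η x (fun i => X i x) = η y (fun i => X i y)) :
    ∃ H : Form m Q k, H.IsSmooth ∧ Form.pullback p H = η := by
  choose r R hr hR using exists_fibre_point hp hsurj
  -- H depends on arbitrary points r q and right inverses R q; `key` shows that the choices do not
  -- matter, and this also yields smoothness.
  let H : Form m Q k := fun q => (η (r q)).compContinuousLinearMap (R q)
  have key : ∀ (X : Fin k → SmoothVF n M) (Y : Fin k → SmoothVF m Q),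
      (∀ i x, mfderiv (𝓡 n) (𝓡 m) p x (X i x) = Y i (p x)) →
      ∀ x, H (p x) (fun i => Y i (p x)) = η x (fun i => X i x) := by
    intro X Y hXY x
    rw [← hconst X Y hXY (r (p x)) x (hr _)]
    exact hhor _ _ _ fun i => (hR _ _).trans (hXY i _).symm
  refine ⟨H, fun Y => contMDiff_of_comp_submersion hp hsurj ?_, ?_⟩
  · choose X hX using fun i => exists_lift hp (Y i)
    exact (hη X).congr (key X Y hX)
  · funext x
    ext u
    -- The vectors dp(u i) are extended to fields on Q and lifted. The lifts have the same
    -- projections as the u i, which is all that η sees.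
    choose Y hY using fun i => exists_section_apply_eq (n := m) (V₁ := EuclideanSpace ℝ (Fin m))
      (E₁ := (Tan m : Q → Type)) (mfderiv (𝓡 n) (𝓡 m) p x (u i))
    choose X hX using fun i => exists_lift hp (Y i)
    have h₁ : Form.pullback p H x u = H (p x) (fun i => Y i (p x)) :=
      congrArg (H (p x)) (funext fun i => (hY i).symm)
    rw [h₁, key X Y hX]
    exact hhor _ _ _ fun i => (hX i x).trans (hY i)

end Courant

/-! ### Descent of transverse metrics; brackets with vertical fields. -/

/-- The unit ball of a positive definite form on a finite-dimensional space is bounded. -/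
theorem isVonNBounded_of_posDef {F : Type*} [NormedAddCommGroup F] [NormedSpace ℝ F]
    [FiniteDimensional ℝ F] (B : F →L[ℝ] F →L[ℝ] ℝ) (hB : ∀ v, v ≠ 0 → 0 < B v v) :
    Bornology.IsVonNBounded ℝ {v : F | B v v < 1} := by
  have := FiniteDimensional.proper ℝ F
  rcases subsingleton_or_nontrivial F with h | h
  · exact (Set.toFinite _).isVonNBounded
  -- With B(w, w) the minimum on the unit sphere, B(v, v) ≥ B(w, w)‖v‖², whence the radius below.
  obtain ⟨w, hw, hmin⟩ := (isCompact_sphere (0 : F) 1).exists_isMinOn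
    (NormedSpace.sphere_nonempty.2 zero_le_one)
    (f := fun v => B v v) (B.continuous.clm_apply continuous_id).continuousOn
  have hc : 0 < B w w := hB w (ne_zero_of_mem_unit_sphere ⟨w, hw⟩)
  refine (NormedSpace.isVonNBounded_closedBall ℝ F (√(B w w))⁻¹).subset fun v hv => ?_
  rw [mem_closedBall_zero_iff]
  rcases eq_or_ne v 0 with rfl | hv₀
  · simp
  have hnorm : 0 < ‖v‖ := norm_pos_iff.2 hv₀
  have h₁ : B w w ≤ B (‖v‖⁻¹ • v) (‖v‖⁻¹ • v) := hmin (by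
    rw [mem_sphere_zero_iff_norm, norm_smul, norm_inv, norm_norm, inv_mul_cancel₀ hnorm.ne'])
  have h₂ : B v v < 1 := hv
  rw [map_smul, map_smul, smul_apply, smul_eq_mul, smul_eq_mul, ← mul_assoc, ← mul_inv,
    le_inv_mul_iff₀ (by positivity)] at h₁
  rw [← Real.sqrt_inv]
  refine Real.le_sqrt_of_sq_le ?_
  rw [inv_eq_one_div, le_div_iff₀ hc]
  nlinarith

namespace Courant

section Descent

variable {n m : ℕ} {M : Type*} [TopologicalSpace M] [ChartedSpace (EuclideanSpace ℝ (Fin n)) M]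
  [IsManifold (𝓡 n) ∞ M] [T2Space M] [SigmaCompactSpace M]
  {Q : Type*} [TopologicalSpace Q] [ChartedSpace (EuclideanSpace ℝ (Fin m)) Q]
  [IsManifold (𝓡 m) ∞ Q] [T2Space Q] [SigmaCompactSpace Q] {p : M → Q}

/-- A transversally positive definite basic symmetric form descends to a Riemannian metric. -/
theorem exists_metric_descent (hp : IsSubmersion (𝓡 n) (𝓡 m) ∞ p) (hsurj : Function.Surjective p)
    {h : ∀ x : M, Tan n x →L[ℝ] Tan n x →L[ℝ] ℝ} (hsymm : ∀ x u v, h x u v = h x v u)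
    (hsmooth : ∀ X Y : SmoothVF n M, ContMDiff (𝓡 n) 𝓘(ℝ, ℝ) ∞ (fun x => h x (X x) (Y x)))
    (hpos : ∀ x u, mfderiv (𝓡 n) (𝓡 m) p x u ≠ 0 → 0 < h x u u)
    (hhor : ∀ x u v, mfderiv (𝓡 n) (𝓡 m) p x u = 0 → h x u v = 0)
    (hconst : ∀ (X₁ X₂ : SmoothVF n M) (Y₁ Y₂ : SmoothVF m Q),
      (∀ x, mfderiv (𝓡 n) (𝓡 m) p x (X₁ x) = Y₁ (p x)) →
      (∀ x, mfderiv (𝓡 n) (𝓡 m) p x (X₂ x) = Y₂ (p x)) →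
      ∀ x y, p x = p y → h x (X₁ x) (X₂ x) = h y (X₁ y) (X₂ y)) :
    ∃ g : RiemMetric m Q, RiemMetric.pullback p g = h := by
  choose r R hr hR using exists_fibre_point hp hsurj
  have hhor' : ∀ x (u u' v v' : Tan n x), mfderiv (𝓡 n) (𝓡 m) p x u = mfderiv (𝓡 n) (𝓡 m) p x u' →
      mfderiv (𝓡 n) (𝓡 m) p x v = mfderiv (𝓡 n) (𝓡 m) p x v' → h x u v = h x u' v' := by
    intro x u u' v v' hu hv
    have h₁ := hhor x (u - u') v (by rw [map_sub, hu, sub_self])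
    have h₂ := hhor x (v - v') u' (by rw [map_sub, hv, sub_self])
    rw [hsymm, map_sub, sub_eq_zero] at h₂
    rw [map_sub, sub_apply, sub_eq_zero] at h₁
    exact h₁.trans h₂
  let G : ∀ q : Q, Tan m q →L[ℝ] Tan m q →L[ℝ] ℝ := fun q =>
    (ContinuousLinearMap.precomp ℝ (R q)) ∘L (h (r q)) ∘L (R q)
  have key : ∀ (X₁ X₂ : SmoothVF n M) (Y₁ Y₂ : SmoothVF m Q),
      (∀ x, mfderiv (𝓡 n) (𝓡 m) p x (X₁ x) = Y₁ (p x)) →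
      (∀ x, mfderiv (𝓡 n) (𝓡 m) p x (X₂ x) = Y₂ (p x)) →
      ∀ x, G (p x) (Y₁ (p x)) (Y₂ (p x)) = h x (X₁ x) (X₂ x) := by
    intro X₁ X₂ Y₁ Y₂ h₁ h₂ x
    rw [← hconst X₁ X₂ Y₁ Y₂ h₁ h₂ (r (p x)) x (hr _)]
    exact hhor' _ _ _ _ _ ((hR _ _).trans (h₁ _).symm) ((hR _ _).trans (h₂ _).symm)
  have hG : ∀ x u v, G (p x) (mfderiv (𝓡 n) (𝓡 m) p x u) (mfderiv (𝓡 n) (𝓡 m) p x v) = h x u v := by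
    intro x u v
    obtain ⟨Y₁, hY₁⟩ := exists_section_apply_eq (n := m) (V₁ := EuclideanSpace ℝ (Fin m))
      (E₁ := (Tan m : Q → Type)) (mfderiv (𝓡 n) (𝓡 m) p x u)
    obtain ⟨Y₂, hY₂⟩ := exists_section_apply_eq (n := m) (V₁ := EuclideanSpace ℝ (Fin m))
      (E₁ := (Tan m : Q → Type)) (mfderiv (𝓡 n) (𝓡 m) p x v)
    obtain ⟨X₁, hX₁⟩ := exists_lift hp Y₁
    obtain ⟨X₂, hX₂⟩ := exists_lift hp Y₂
    rw [← hY₁, ← hY₂, key X₁ X₂ Y₁ Y₂ hX₁ hX₂]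
    exact hhor' _ _ _ _ _ ((hX₁ x).trans hY₁) ((hX₂ x).trans hY₂)
  have hGpos : ∀ q (v : Tan m q), v ≠ 0 → 0 < G q v v := by
    intro q v hv
    obtain ⟨x, rfl⟩ := hsurj q
    obtain ⟨u, rfl⟩ := (hp.isSubmersionAt x).mfderiv_surjective v
    rw [hG]
    exact hpos x u hv
  refine ⟨⟨G, fun q v w => hsymm _ _ _, hGpos, fun q => ?_, ?_⟩, ?_⟩
  · exact isVonNBounded_of_posDef (F := EuclideanSpace ℝ (Fin m)) (G q) (hGpos q)
  · refine contMDiff_hom_of_apply (E₂ := fun q : Q => Tan m q →L[ℝ] (Bundle.Trivial Q ℝ q))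
      fun Y₁ => contMDiff_hom_of_apply (E₂ := Bundle.Trivial Q ℝ) fun Y₂ =>
        contMDiff_scalar_iff.2 (contMDiff_of_comp_submersion hp hsurj ?_)
    obtain ⟨X₁, hX₁⟩ := exists_lift hp Y₁
    obtain ⟨X₂, hX₂⟩ := exists_lift hp Y₂
    exact (hsmooth X₁ X₂).congr (key X₁ X₂ Y₁ Y₂ hX₁ hX₂)
  · funext x
    ext u v
    exact hG x u v

/-- The bracket of a vertical and a projectable vector field is vertical. -/
theorem mfderiv_vfBracket_eq_zero (hp : ContMDiff (𝓡 n) (𝓡 m) ∞ p) {U X : SmoothVF n M}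
    {Y : SmoothVF m Q} (hU : ∀ x, mfderiv (𝓡 n) (𝓡 m) p x (U x) = 0)
    (hX : ∀ x, mfderiv (𝓡 n) (𝓡 m) p x (X x) = Y (p x)) (x : M) :
    mfderiv (𝓡 n) (𝓡 m) p x (vfBracket U X x) = 0 := by
  -- A vertical field is one that is related to the zero field.
  have h₁ := mfderiv_mlieBracket_of_related hp (V' := 0) hU hX x
  have h₂ : VectorField.mlieBracket (𝓡 m) (0 : SmoothVF m Q) Y = 0 :=
    VectorField.mlieBracket_zero_left
  rw [h₂] at h₁
  exact h₁

end Descent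

/-! ### The 3-form is basic for ρ(D). -/

variable {n : ℕ} {M : Type*} [TopologicalSpace M] [ChartedSpace (EuclideanSpace ℝ (Fin n)) M]
  [IsManifold (𝓡 n) ∞ M] [T2Space M] [SigmaCompactSpace M]
  {V : Type*} [NormedAddCommGroup V] [NormedSpace ℝ V] [FiniteDimensional ℝ V]
  {E : M → Type*} [∀ x, AddCommGroup (E x)] [∀ x, Module ℝ (E x)]
  [TopologicalSpace (TotalSpace V E)] [∀ x, TopologicalSpace (E x)]
  [∀ x, IsTopologicalAddGroup (E x)] [∀ x, ContinuousSMul ℝ (E x)]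
  [FiberBundle V E] [VectorBundle ℝ V E] [ContMDiffVectorBundle ∞ V E (𝓡 n)]
  {A : CourantAlgebroid n V E} {D W : ∀ x : M, Submodule ℝ (E x)}

/-- A vector in `ρ(D)` extends to a vector field with values in `ρ(D)`. -/
theorem IsSmallDirac.exists_vectorField (hD : IsSmallDirac A D) {x : M} {u : Tan n x}
    (hu : u ∈ anchorImage A D x) :
    ∃ U : SmoothVF n M, (∀ y, U y ∈ anchorImage A D y) ∧ U x = u := by
  obtain ⟨d, hd, rfl⟩ := hu
  obtain ⟨a, ha, rfl⟩ := hD.isSubbundle.exists_section_apply_eq hd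
  exact ⟨A.anchorSec a, fun y => ⟨a y, ha y, rfl⟩, rfl⟩

theorem Splitting.isSmooth_threeForm (s : Splitting A) : s.threeForm.IsSmooth := fun X =>
  (s.contMDiff_torsion (X 0) (X 1) (X 2)).congr (s.threeForm_apply X)

theorem Splitting.hasThreeForm (s : Splitting A) : s.HasThreeForm s.threeForm := by
  intro X Y Z x
  refine Eq.trans (congrArg _ (funext fun i => ?_)) (s.threeForm_apply ![X, Y, Z] x)
  fin_cases i <;> rfl

namespace AnchorLift

variable (σ : AnchorLift A W) {U : SmoothVF n M}

/-- The Lie derivative of the 3-form along U vanishes: [sU, ·] is a derivation of the bracket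
(Jacobi) and of the pairing, and it commutes with s. -/
theorem mvfderiv_torsion (hW : IsTransverseGenMetric A D W) (hA : A.IsExact)
    (hproj : IsProjectable A D) (hU : ∀ x, U x ∈ anchorImage A D x) (X Y Z : SmoothVF n M) (x : M) :
    mvfderiv (𝓡 n) ((σ.splitting hA).torsion X Y Z) x (U x) =
      (σ.splitting hA).torsion (vfBracket U X) Y Z x +
      (σ.splitting hA).torsion X (vfBracket U Y) Z x +
      (σ.splitting hA).torsion X Y (vfBracket U Z) x := by
  have h₁ := A.invariance_of_anchor_eq (a := (σ.splitting hA).sec U)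
    (fun y => (σ.splitting hA).anchor_apply y (U y))
    (A.bracket ((σ.splitting hA).sec X) ((σ.splitting hA).sec Y)) ((σ.splitting hA).sec Z) x
  rw [A.jacobi, σ.bracket_splitting_sec hW hA hproj hU, σ.bracket_splitting_sec hW hA hproj hU,
    σ.bracket_splitting_sec hW hA hproj hU, ContMDiffSection.coe_add, Pi.add_apply, map_add,
    add_apply] at h₁
  exact h₁

/-- For U in ρ(D), [sU, sX] = s[U, X] is orthogonal to the image of s. A single vector of ρ(D) is
first extended to such a U and rotated to the first slot. -/
theorem threeForm_eq_zero (hW : IsTransverseGenMetric A D W) (hA : A.IsExact)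
    (hproj : IsProjectable A D) (hD : IsSmallDirac A D) {x : M} {u : Fin 3 → Tan n x} {i : Fin 3}
    (hu : u i ∈ anchorImage A D x) : (σ.splitting hA).threeForm x u = 0 := by
  have h₀ : ∀ {U : SmoothVF n M}, (∀ x, U x ∈ anchorImage A D x) → ∀ X Y : SmoothVF n M,
      (σ.splitting hA).torsion U X Y x = 0 := by
    intro U hU X Y
    rw [Splitting.torsion, σ.bracket_splitting_sec hW hA hproj hU]
    exact (σ.splitting hA).isotropic x _ _
  obtain ⟨U, hU, hUx⟩ := hD.exists_vectorField hu
  choose X hX using fun j => exists_section_apply_eq (n := n) (V₁ := EuclideanSpace ℝ (Fin n))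
      (E₁ := (Tan n : M → Type)) (u j)
  have h₁ : u = fun j => Function.update X i U j x := by
    funext j
    by_cases hij : j = i
    · subst hij
      rw [Function.update_self, hUx]
    · rw [Function.update_of_ne hij, hX]
  rw [h₁, Splitting.threeForm_apply]
  fin_cases i
  · exact h₀ hU _ _
  · rw [← Splitting.torsion_rotate]
    exact h₀ hU _ _
  · rw [← Splitting.torsion_rotate, ← Splitting.torsion_rotate]
    exact h₀ hU _ _

end AnchorLift

end Courant

end

/-! ### Assembly of the proposition. -/

theorem mainTheorem2 {n m : ℕ}
    {M : Type*} [TopologicalSpace M] [ChartedSpace (EuclideanSpace ℝ (Fin n)) M]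
    [IsManifold (𝓡 n) ∞ M] [T2Space M] [SigmaCompactSpace M]
    {Q : Type*} [TopologicalSpace Q] [ChartedSpace (EuclideanSpace ℝ (Fin m)) Q]
    [IsManifold (𝓡 m) ∞ Q] [T2Space Q] [SigmaCompactSpace Q]
    {V : Type*} [NormedAddCommGroup V] [NormedSpace ℝ V] [FiniteDimensional ℝ V]
    {E : M → Type*} [∀ x, AddCommGroup (E x)] [∀ x, Module ℝ (E x)]
    [TopologicalSpace (TotalSpace V E)] [∀ x, TopologicalSpace (E x)]
    [∀ x, IsTopologicalAddGroup (E x)] [∀ x, ContinuousSMul ℝ (E x)]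
    [FiberBundle V E] [VectorBundle ℝ V E] [ContMDiffVectorBundle ∞ V E (𝓡 n)]
    (A : CourantAlgebroid n V E) (hA : A.IsExact)
    (D : ∀ x : M, Submodule ℝ (E x)) (hD : IsSmallDirac A D) (hproj : IsProjectable A D)
    (p : M → Q) (hp : IsSubmersion (𝓡 n) (𝓡 m) ∞ p) (hsurj : Function.Surjective p)
    (hleaf : ∀ L : Set M, IsLeaf (anchorImage A D) L ↔ ∃ q : Q, p ⁻¹' {q} = L)
    (W : ∀ x : M, Submodule ℝ (E x)) (hW : IsTransverseGenMetric A D W) :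
    ∃! s : Splitting A, ∃ (H : Form m Q 3) (g : RiemMetric m Q),
      Form.IsSmooth H ∧ Form.IsClosed H ∧ s.HasThreeForm (Form.pullback p H) ∧
        W = s.graph (RiemMetric.pullback p g) := by
  obtain ⟨σ⟩ := hW.nonempty_anchorLift hA hproj
  have hfib : ∀ q, IsConnectedIntegralManifold (anchorImage A D) (p ⁻¹' {q}) := fun q =>
    ((hleaf _).2 ⟨q, rfl⟩).1
  have hker : ∀ {x} {u : Tan n x}, u ∈ anchorImage A D x ↔ mfderiv (𝓡 n) (𝓡 m) p x u = 0 := by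
    intro x u
    rw [(hfib (p x)).eq_ker hp]
    exact LinearMap.mem_ker
  have hconst : ∀ {f : M → ℝ}, ContMDiff (𝓡 n) 𝓘(ℝ, ℝ) ∞ f →
      (∀ U : SmoothVF n M, (∀ x, U x ∈ anchorImage A D x) → ∀ x, mvfderiv (𝓡 n) f x (U x) = 0) →
      ∀ x y, p x = p y → f x = f y := by
    intro f hf hU x y hxy
    refine (hfib (p y)).apply_eq hf (fun z u hu => ?_) hxy rfl
    obtain ⟨U, hU', rfl⟩ := hD.exists_vectorField hu
    exact hU U hU' z
  -- Brackets of U with projectable fields stay vertical, so on lifts every term in the Lie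
  -- derivative formulas for H and g has an argument in ρ(D) and vanishes.
  have hbr : ∀ {U X : SmoothVF n M} {Y : SmoothVF m Q}, (∀ x, U x ∈ anchorImage A D x) →
      (∀ x, mfderiv (𝓡 n) (𝓡 m) p x (X x) = Y (p x)) → ∀ x,
      vfBracket U X x ∈ anchorImage A D x := fun hU hX x =>
    hker.2 (mfderiv_vfBracket_eq_zero hp.contMDiff (fun y => hker.1 (hU y)) hX x)
  obtain ⟨H, hH, hpH⟩ : ∃ H : Form m Q 3, H.IsSmooth ∧
      Form.pullback p H = (σ.splitting hA).threeForm := by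
    refine exists_form_descent hp hsurj (σ.splitting hA).isSmooth_threeForm (fun x u v huv => ?_)
      fun X Y hXY => hconst ((σ.splitting hA).isSmooth_threeForm X) fun U hU x => ?_
    · refine ((σ.splitting hA).threeForm x).toMultilinearMap.apply_eq_of_sub_mem
        (K := anchorImage A D x) (fun w i hi => σ.threeForm_eq_zero hW hA hproj hD hi) fun i => ?_
      rw [hker, map_sub, huv, sub_self]
    · have h₀ : ∀ (i : Fin 3) (Z : Fin 3 → SmoothVF n M), Z i x ∈ anchorImage A D x →
          (σ.splitting hA).torsion (Z 0) (Z 1) (Z 2) x = 0 := by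
        intro i Z hZ
        rw [← Splitting.threeForm_apply]
        exact σ.threeForm_eq_zero hW hA hproj hD hZ
      rw [show (fun y => (σ.splitting hA).threeForm y fun i => X i y) =
        (σ.splitting hA).torsion (X 0) (X 1) (X 2) from
        funext ((σ.splitting hA).threeForm_apply X), σ.mvfderiv_torsion hW hA hproj hU]
      have h₁ := h₀ 0 ![vfBracket U (X 0), X 1, X 2] (hbr hU (hXY 0) x)
      have h₂ := h₀ 1 ![X 0, vfBracket U (X 1), X 2] (hbr hU (hXY 1) x)
      have h₃ := h₀ 2 ![X 0, X 1, vfBracket U (X 2)] (hbr hU (hXY 2) x)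
      exact (congrArg₂ _ (congrArg₂ _ h₁ h₂) h₃).trans (by norm_num)
  -- The factor ½ is the one forced by W being the graph of g.
  obtain ⟨g, hg⟩ : ∃ g : RiemMetric m Q,
      RiemMetric.pullback p g = fun x => (2⁻¹ : ℝ) • σ.inner x := by
    refine exists_metric_descent hp hsurj (fun x u v => ?_) (fun X Y => ?_) (fun x u hu => ?_)
      (fun x u v hu => ?_) fun X₁ X₂ Y₁ Y₂ h₁ h₂ x y hxy => ?_
    · exact congrArg (fun t : ℝ => 2⁻¹ * t) (σ.inner_symm x u v)
    · exact (contMDiff_const (I' := 𝓘(ℝ, ℝ)) (c := (2⁻¹ : ℝ))).smul (σ.contMDiff_inner_apply X Y)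
    · exact mul_pos (by norm_num) (σ.inner_self_pos hW hA hproj fun h => hu (hker.1 h))
    · exact (congrArg (fun t : ℝ => 2⁻¹ * t)
        (σ.inner_eq_zero_of_mem hW hA hproj (hker.2 hu) v)).trans (mul_zero _)
    · refine congrArg (fun t : ℝ => 2⁻¹ * t) (hconst (σ.contMDiff_inner_apply X₁ X₂)
        (fun U hU x => ?_) x y hxy)
      rw [σ.mvfderiv_inner hW hA hproj hU, σ.inner_symm x (X₁ x),
        σ.inner_eq_zero_of_mem hW hA hproj (hbr hU h₁ x),
        σ.inner_eq_zero_of_mem hW hA hproj (hbr hU h₂ x), add_zero]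
  refine ⟨σ.splitting hA, ⟨H, g, hH, fun Y q => ?_, ?_, ?_⟩, ?_⟩
  -- Fields on Q lift to M, so dH at p x is computed from lifts by the closed form upstairs.
  · obtain ⟨x, rfl⟩ := hsurj q
    choose X hX using fun i => exists_lift hp (Y i)
    rw [← extDerivOn_pullback hp.contMDiff hH hX, hpH]
    exact (σ.splitting hA).isClosed_threeForm hA X x
  · rw [hpH]
    exact (σ.splitting hA).hasThreeForm
  · exact σ.eq_graph hW hA hproj fun x u v => congrArg (fun h => h x u v) hg
  · rintro s ⟨H', g', -, -, -, hgraph⟩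
    exact σ.eq_splitting_of_eq_graph hA (fun x u v => g'.symm _ _ _) hgraph
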